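/- Let $\mathcal B=(\mathbb R/2\pi\mathbb Z)\times(\mathbb R/2\pi\mathbb Z)$, with coordinates $(k_x,k_y)$, be the Brillouin torus of the wallpaper group $\mathsf{pg}$, with the action of $\mathbb Z_2=\{1,-1\}$ given by $(-1)\cdot(k_x,k_y)=(k_x,-k_y)$. Let $\hat\nu$ be the $2$-cocycle of $\mathbb Z_2$ with values in $C(\mathcal B,\mathrm U(1))$ given by $\hat\nu(-1,-1)(k_x,k_y)=e^{\mathrm i k_x}$ and $\hat\nu(a,b)=1$ for all other pairs $(a,b)$. A $\hat\nu$-twisted $\mathbb Z_2$-equivariant bundle on $\mathcal B$ is a complex vector bundle $\mathcal E\to\mathcal B$ of finite rank with vector bundle isomorphisms $L_a:\mathcal E\to\mathcal E$ $(a\in\mathbb Z_2)$ covering the action of $a$ on $\mathcal B$, such that $L_aL_b\psi=\hat\nu(a,b)(ab\cdot k)\,L_{ab}\psi$ for all $a,b\in\mathbb Z_2$, $k\in\mathcal B$ and $\psi\in\mathcal E|_k$ (equivalently, $L_1=\mathrm{id}$ and $L_{-1}^2$ is multiplication by $e^{\mathrm i k_x}$). An isomorphism of twisted bundles is an isomorphism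 of complex vector bundles over $\mathrm{id}_{\mathcal B}$ that commutes with the maps $L_a$. Let $K^{0+\hat\nu}_{\mathbb Z_2}(\mathcal B)$ be the Grothendieck group of the commutative monoid of isomorphism classes of $\hat\nu$-twisted $\mathbb Z_2$-equivariant bundles on $\mathcal B$ under direct sum. Let $\mathcal E_{\mathrm{reg}}$ be the product bundle $\mathcal B\times\mathbb C^2$ with $L_1=\mathrm{id}$ and $$L_{-1}\big((k_x,k_y),\psi\big)=\Big((k_x,-k_y),\begin{pmatrix}0&e^{\mathrm i k_x}\\1&0\end{pmatrix}\psi\Big).$$ Then: 1. For every $\hat\nu$-twisted $\mathbb Z_2$-equivariant bundle $\mathcal E$ on $\mathcal B$, the underlying complex vector bundle of $\mathcal E$ is trivialisable (isomorphic to $\mathcal B\times\mathbb C^{r}$, $r=\operatorname{rank}\mathcal E$), and $\operatorname{rank}\mathcal E$ is even. 2. There is an isomorphism of groups $K^{0+\hat\nu}_{\mathbb Z_2}(\mathcal B)\cong\mathbb Z$ which sends the class $[\mathcal E]$ of every twisted bundle $\mathcal E$ to $\tfrac12\operatorname{rank}\mathcal E$. It sends $[\mathcal E_{\mathrm{reg}}]$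 to $1$; in particular $[\mathcal E_{\mathrm{reg}}]$ generates $K^{0+\hat\nu}_{\mathbb Z_2}(\mathcal B)$. -/

import Mathlib

universe u v w

noncomputable section

open Bundle

/-! ### Complex vector bundles and their isomorphisms -/

/-- A complex vector bundle of finite rank over `B`: a family of complex vector spaces `E x` whose
total space is topologised as a locally trivial vector bundle with model fibre `Fib`. -/
structure ComplexBundle (B : Type v) [TopologicalSpace B] where
  /-- the model fibre, a finite-dimensional complex vector space -/
  Fib : Type u
  /-- the fibres -/
  E : B → Type u
  [instFibGroup : NormedAddCommGroup Fib]
  [instFibSpace : NormedSpace ℂ Fib]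
  [instFibFinite : FiniteDimensional ℂ Fib]
  [instGroup : ∀ x, AddCommGroup (E x)]
  [instModule : ∀ x, Module ℂ (E x)]
  [instTop : ∀ x, TopologicalSpace (E x)]
  [instTotal : TopologicalSpace (TotalSpace Fib E)]
  [instFiberBundle : FiberBundle Fib E]
  [instVectorBundle : VectorBundle ℂ Fib E]

attribute [instance] ComplexBundle.instFibGroup ComplexBundle.instFibSpace
  ComplexBundle.instFibFinite ComplexBundle.instGroup ComplexBundle.instModule
  ComplexBundle.instTop ComplexBundle.instTotal ComplexBundle.instFiberBundle
  ComplexBundle.instVectorBundle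

namespace ComplexBundle

/-- The total space of a complex vector bundle. -/
abbrev Total {B : Type*} [TopologicalSpace B] (V : ComplexBundle B) : Type _ :=
  TotalSpace V.Fib V.E

/-- The rank of a complex vector bundle. -/
def rank {B : Type*} [TopologicalSpace B] (V : ComplexBundle B) : ℕ :=
  Module.finrank ℂ V.Fib

/-- The product bundle `B × F`. -/
abbrev product (B : Type v) [TopologicalSpace B] (F : Type u) [NormedAddCommGroup F]
    [NormedSpace ℂ F] [FiniteDimensional ℂ F] : ComplexBundle.{u, v} B where
  Fib := F
  E := Bundle.Trivial B F

/-- The direct (Whitney) sum of two complex vector bundles. -/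
abbrev directSum {B : Type v} [TopologicalSpace B] (V W : ComplexBundle.{u, v} B) :
    ComplexBundle.{u, v} B where
  Fib := V.Fib × W.Fib
  E := fun x ↦ V.E x × W.E x
  instTop := fun _ ↦ inferInstance
  instTotal := FiberBundle.Prod.topologicalSpace V.Fib V.E W.Fib W.E
  instFiberBundle := FiberBundle.prod V.Fib V.E W.Fib W.E
  instVectorBundle := VectorBundle.prod ℂ V.Fib V.E W.Fib W.E

/-- An isomorphism of complex vector bundles over `B`, covering the identity of `B`: fibrewise
linear isomorphisms that are continuous in both directions on the total spaces. -/
structure Iso {B : Type v} [TopologicalSpace B] (V : ComplexBundle.{u, v} B)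
    (W : ComplexBundle.{w, v} B) where
  /-- the isomorphism on the fibre over `x` -/
  map : ∀ x, V.E x ≃ₗ[ℂ] W.E x
  continuous_map : Continuous (fun p : V.Total ↦ (⟨p.1, map p.1 p.2⟩ : W.Total))
  continuous_symm : Continuous (fun p : W.Total ↦ (⟨p.1, (map p.1).symm p.2⟩ : V.Total))

/-- A complex vector bundle is trivialisable if it is isomorphic to a product bundle
`B × ℂ ^ r`, where `r` is its rank. -/
def IsTrivialisable {B : Type*} [TopologicalSpace B] (V : ComplexBundle B) : Prop :=
  Nonempty (Iso V (product B (EuclideanSpace ℂ (Fin V.rank))))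

namespace Iso

variable {B : Type*} [TopologicalSpace B]

/-- The identity isomorphism. -/
def refl (V : ComplexBundle B) : Iso V V where
  map := fun _ ↦ LinearEquiv.refl ℂ _
  continuous_map := continuous_id
  continuous_symm := continuous_id

/-- The inverse isomorphism. -/
def symm {V W : ComplexBundle B} (f : Iso V W) : Iso W V where
  map := fun x ↦ (f.map x).symm
  continuous_map := f.continuous_symm
  continuous_symm := f.continuous_map

/-- The composite of two isomorphisms. -/
def trans {V W X : ComplexBundle B} (f : Iso V W) (g : Iso W X) : Iso V X where
  map := fun x ↦ (f.map x).trans (g.map x)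
  continuous_map := g.continuous_map.comp f.continuous_map
  continuous_symm := f.continuous_symm.comp g.continuous_symm

end Iso

theorem continuous_fst {B : Type*} [TopologicalSpace B] (V W : ComplexBundle B) :
    Continuous (fun p : (directSum V W).Total ↦ (⟨p.1, p.2.1⟩ : V.Total)) :=
  (_root_.continuous_fst).comp
    (FiberBundle.Prod.isInducing_diag V.Fib V.E W.Fib W.E).continuous

theorem continuous_snd {B : Type*} [TopologicalSpace B] (V W : ComplexBundle B) :
    Continuous (fun p : (directSum V W).Total ↦ (⟨p.1, p.2.2⟩ : W.Total)) :=
  (_root_.continuous_snd).comp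
    (FiberBundle.Prod.isInducing_diag V.Fib V.E W.Fib W.E).continuous

theorem continuous_mk {B X : Type*} [TopologicalSpace B] [TopologicalSpace X]
    (V W : ComplexBundle B) (b : X → B) (f : ∀ t, V.E (b t)) (g : ∀ t, W.E (b t))
    (hf : Continuous (fun t ↦ (⟨b t, f t⟩ : V.Total)))
    (hg : Continuous (fun t ↦ (⟨b t, g t⟩ : W.Total))) :
    Continuous (fun t ↦ (⟨b t, (f t, g t)⟩ : (directSum V W).Total)) :=
  (FiberBundle.Prod.isInducing_diag V.Fib V.E W.Fib W.E).continuous_iff.2 (hf.prodMk hg)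

end ComplexBundle

/-! ### Twisted equivariant bundles -/

/-- A `2`-cocycle of the group `G` with values in the continuous `U(1)`-valued functions on the
`G`-space `B`, where `G` acts on functions by `(a · f) x = f (a⁻¹ • x)`. -/
structure EquivariantTwist (G B : Type*) [Group G] [TopologicalSpace B] [MulAction G B]
    [ContinuousConstSMul G B] where
  /-- the cocycle -/
  val : G → G → C(B, Circle)
  cocycle : ∀ a b c x,
    val a b x * val (a * b) c x = val b c (a⁻¹ • x) * val a (b * c) x

/-- A `ν`-twisted `G`-equivariant complex vector bundle over `B`: a complex vector bundle with
bundle isomorphisms `L a`, covering the action of `a` on `B`, such that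
`L a (L b ψ) = ν(a, b)((a b) • x) L (a b) ψ` for `ψ` in the fibre over `x`. -/
structure TwistedBundle {G : Type w} {B : Type v} [Group G] [TopologicalSpace B]
    [MulAction G B] [ContinuousConstSMul G B] (ν : EquivariantTwist G B)
    extends ComplexBundle.{u, v} B where
  /-- the twisted action on fibres -/
  L : ∀ (a : G) (x : B), E x ≃ₗ[ℂ] E (a • x)
  continuous_L : ∀ a : G, Continuous
    (fun p : TotalSpace Fib E ↦ (⟨a • p.1, L a p.1 p.2⟩ : TotalSpace Fib E))
  L_L : ∀ (a b : G) (x : B) (ψ : E x),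
    (⟨a • b • x, L a (b • x) (L b x ψ)⟩ : TotalSpace Fib E) =
      ⟨(a * b) • x, (ν.val a b ((a * b) • x) : ℂ) • L (a * b) x ψ⟩

namespace TwistedBundle

open ComplexBundle

/-- Equality in the total space of a direct sum can be checked on the two summands. -/
theorem total_ext {B : Type*} [TopologicalSpace B] (V W : ComplexBundle B) {x y : B}
    {v : V.E x} {w : W.E x} {v' : V.E y} {w' : W.E y}
    (hv : (⟨x, v⟩ : V.Total) = ⟨y, v'⟩) (hw : (⟨x, w⟩ : W.Total) = ⟨y, w'⟩) :
    (⟨x, (v, w)⟩ : (directSum V W).Total) = ⟨y, (v', w')⟩ := by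
  cases hv
  cases hw
  rfl

section

variable {G : Type w} {B : Type v} [Group G] [TopologicalSpace B] [MulAction G B]
  [ContinuousConstSMul G B] {ν : EquivariantTwist G B}

/-- The direct sum of twisted bundles. -/
abbrev directSum (V W : TwistedBundle.{u} ν) : TwistedBundle.{u} ν where
  toComplexBundle := V.toComplexBundle.directSum W.toComplexBundle
  L := fun a x ↦ (V.L a x).prodCongr (W.L a x)
  continuous_L := fun a ↦ continuous_mk V.toComplexBundle W.toComplexBundle
    _ _ _
    ((V.continuous_L a).comp (continuous_fst _ _))
    ((W.continuous_L a).comp (continuous_snd _ _))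
  L_L := fun a b x ψ ↦ total_ext V.toComplexBundle W.toComplexBundle
    (V.L_L a b x ψ.1) (W.L_L a b x ψ.2)

variable (ν) in
/-- The twisted bundle of rank zero. -/
abbrev zero : TwistedBundle.{u} ν where
  toComplexBundle := product B PUnit.{u + 1}
  L := fun _ _ ↦ LinearEquiv.refl ℂ PUnit.{u + 1}
  continuous_L := fun a ↦ (Trivial.isInducing_toProd B PUnit.{u + 1}).continuous_iff.2
    (((continuous_const_smul a).comp
      ((_root_.continuous_fst).comp (Trivial.isInducing_toProd B PUnit.{u + 1}).continuous)).prodMk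
        (continuous_const (y := PUnit.unit.{u + 1})))
  L_L := fun a b x ψ ↦ by
    have h : a • b • x = (a * b) • x := (mul_smul a b x).symm
    exact congrArg (fun y ↦ (⟨y, PUnit.unit.{u + 1}⟩ : TotalSpace PUnit.{u + 1} (Bundle.Trivial B PUnit.{u + 1}))) h

/-- Two twisted bundles are isomorphic if there is an isomorphism of complex vector bundles that
intertwines the twisted actions. -/
def IsIso (V W : TwistedBundle.{u} ν) : Prop :=
  ∃ f : Iso V.toComplexBundle W.toComplexBundle,
    ∀ (a : G) (x : B) (ψ : V.E x), f.map (a • x) (V.L a x ψ) = W.L a x (f.map x ψ)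

variable (ν) in
/-- Isomorphism of twisted bundles as an equivalence relation. -/
instance isoSetoid : Setoid (TwistedBundle.{u} ν) where
  r := IsIso
  iseqv :=
    { refl := fun V ↦ ⟨Iso.refl _, fun _ _ _ ↦ rfl⟩
      symm := by
        rintro V W ⟨f, hf⟩
        refine ⟨f.symm, fun a x ψ ↦ ?_⟩
        change (f.map (a • x)).symm _ = V.L a x ((f.map x).symm ψ)
        rw [LinearEquiv.symm_apply_eq, hf, LinearEquiv.apply_symm_apply]
      trans := by
        rintro V W X ⟨f, hf⟩ ⟨g, hg⟩
        refine ⟨f.trans g, fun a x ψ ↦ ?_⟩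
        change g.map (a • x) (f.map (a • x) _) = X.L a x (g.map x (f.map x ψ))
        rw [hf, hg] }

theorem directSum_congr {V V' W W' : TwistedBundle.{u} ν} (hV : V ≈ V') (hW : W ≈ W') :
    V.directSum W ≈ V'.directSum W' := by
  obtain ⟨f, hf⟩ := hV
  obtain ⟨g, hg⟩ := hW
  refine ⟨⟨fun x ↦ (f.map x).prodCongr (g.map x), ?_, ?_⟩, ?_⟩
  · exact continuous_mk V'.toComplexBundle W'.toComplexBundle _ _ _
      (f.continuous_map.comp (continuous_fst _ _)) (g.continuous_map.comp (continuous_snd _ _))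
  · exact continuous_mk V.toComplexBundle W.toComplexBundle _ _ _
      (f.continuous_symm.comp (continuous_fst _ _)) (g.continuous_symm.comp (continuous_snd _ _))
  · exact fun a x ψ ↦ Prod.ext (hf a x ψ.1) (hg a x ψ.2)

theorem directSum_comm (V W : TwistedBundle.{u} ν) : V.directSum W ≈ W.directSum V := by
  refine ⟨⟨fun x ↦ LinearEquiv.prodComm ℂ (V.E x) (W.E x), ?_, ?_⟩, fun _ _ _ ↦ rfl⟩
  · exact continuous_mk W.toComplexBundle V.toComplexBundle _ _ _
      (continuous_snd _ _) (continuous_fst _ _)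
  · exact continuous_mk V.toComplexBundle W.toComplexBundle _ _ _
      (continuous_snd _ _) (continuous_fst _ _)

theorem directSum_assoc (V W X : TwistedBundle.{u} ν) :
    (V.directSum W).directSum X ≈ V.directSum (W.directSum X) := by
  refine ⟨⟨fun x ↦ LinearEquiv.prodAssoc ℂ (V.E x) (W.E x) (X.E x), ?_, ?_⟩, fun _ _ _ ↦ rfl⟩
  · have h := continuous_fst (V.directSum W).toComplexBundle X.toComplexBundle
    exact continuous_mk V.toComplexBundle (W.directSum X).toComplexBundle _ _ _
      ((continuous_fst _ _).comp h)
      (continuous_mk W.toComplexBundle X.toComplexBundle _ _ _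
        ((continuous_snd _ _).comp h) (continuous_snd _ _))
  · have h := continuous_snd V.toComplexBundle (W.directSum X).toComplexBundle
    exact continuous_mk (V.directSum W).toComplexBundle X.toComplexBundle _ _ _
      (continuous_mk V.toComplexBundle W.toComplexBundle _ _ _
        (continuous_fst _ _) ((continuous_fst _ _).comp h))
      ((continuous_snd _ _).comp h)

theorem zero_directSum (V : TwistedBundle.{u} ν) : (zero ν).directSum V ≈ V := by
  refine ⟨⟨fun x ↦ (LinearEquiv.uniqueProd : (PUnit.{u + 1} × V.E x) ≃ₗ[ℂ] V.E x), ?_, ?_⟩, fun _ _ _ ↦ rfl⟩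
  · exact continuous_snd _ _
  · refine continuous_mk (zero ν).toComplexBundle V.toComplexBundle _ (fun _ ↦ PUnit.unit) _
      ?_ continuous_id
    exact (Trivial.isInducing_toProd B PUnit.{u + 1}).continuous_iff.2
      ((FiberBundle.continuous_proj V.Fib V.E).prodMk continuous_const)

end

end TwistedBundle

/-- The set of isomorphism classes of `ν`-twisted `G`-equivariant bundles. -/
def TwistedVect {G : Type w} {B : Type v} [Group G] [TopologicalSpace B] [MulAction G B]
    [ContinuousConstSMul G B] (ν : EquivariantTwist G B) : Type _ :=
  Quotient (TwistedBundle.isoSetoid.{u} ν)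

section

variable {G : Type w} {B : Type v} [Group G] [TopologicalSpace B] [MulAction G B]
  [ContinuousConstSMul G B]

/-- The isomorphism class of a twisted bundle. -/
def TwistedVect.mk {ν : EquivariantTwist G B} (V : TwistedBundle.{u} ν) : TwistedVect.{u} ν :=
  Quotient.mk _ V

/-- Isomorphism classes form a commutative monoid under direct sum. -/
instance TwistedVect.addCommMonoid (ν : EquivariantTwist G B) :
    AddCommMonoid (TwistedVect.{u} ν) where
  add := Quotient.map₂ TwistedBundle.directSum
    fun _ _ h _ _ h' ↦ TwistedBundle.directSum_congr h h'
  zero := Quotient.mk _ (TwistedBundle.zero.{u} ν)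
  add_assoc := by
    rintro ⟨V⟩ ⟨W⟩ ⟨X⟩
    exact Quotient.sound (TwistedBundle.directSum_assoc V W X)
  zero_add := by
    rintro ⟨V⟩
    exact Quotient.sound (TwistedBundle.zero_directSum V)
  add_zero := by
    rintro ⟨V⟩
    exact Quotient.sound
      (Setoid.trans (TwistedBundle.directSum_comm V _) (TwistedBundle.zero_directSum V))
  add_comm := by
    rintro ⟨V⟩ ⟨W⟩
    exact Quotient.sound (TwistedBundle.directSum_comm V W)
  nsmul := @nsmulRec _ ⟨Quotient.mk _ (TwistedBundle.zero.{u} ν)⟩ ⟨Quotient.map₂ TwistedBundle.directSum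
    fun _ _ h _ _ h' ↦ TwistedBundle.directSum_congr h h'⟩

/-- The twisted equivariant `K`-theory group: the Grothendieck group of the monoid of isomorphism
classes of finite-rank twisted bundles. -/
abbrev TwistedK (ν : EquivariantTwist G B) : Type _ :=
  Algebra.GrothendieckAddGroup (TwistedVect.{u} ν)

/-- The class of a twisted bundle in `K`-theory. -/
def TwistedBundle.kClass {ν : EquivariantTwist G B} (V : TwistedBundle.{u} ν) : TwistedK.{u} ν :=
  Algebra.GrothendieckAddGroup.of (TwistedVect.mk V)

end

/-! ### The Brillouin torus of the wallpaper group `pg` -/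

/-- The Brillouin torus `(ℝ / 2πℤ) × (ℝ / 2πℤ)`, with coordinates `(k_x, k_y)`. -/
def PgTorus : Type := Real.Angle × Real.Angle

namespace PgTorus

instance : TopologicalSpace PgTorus := inferInstanceAs (TopologicalSpace (Real.Angle × Real.Angle))

/-- The point group `ℤ₂ = {1, -1}` acts by `(-1) • (k_x, k_y) = (k_x, -k_y)`. -/
instance : MulAction ℤˣ PgTorus where
  smul a k := (k.1, (a : ℤ) • k.2)
  one_smul k := Prod.ext rfl (one_zsmul k.2)
  mul_smul a b k := Prod.ext rfl (by
    change ((a * b : ℤˣ) : ℤ) • k.2 = (a : ℤ) • (b : ℤ) • k.2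
    rw [Units.val_mul, mul_zsmul']; rw [zsmul_comm])

theorem smul_def (a : ℤˣ) (k : PgTorus) : a • k = (k.1, (a : ℤ) • k.2) := rfl

instance : ContinuousConstSMul ℤˣ PgTorus where
  continuous_const_smul a :=
    (_root_.continuous_fst (X := Real.Angle) (Y := Real.Angle)).prodMk
      ((_root_.continuous_snd (X := Real.Angle) (Y := Real.Angle)).zsmul (a : ℤ))

/-- The function `u_x (k_x, k_y) = exp (i k_x)`. -/
def ux : C(PgTorus, Circle) where
  toFun k := k.1.toCircle
  continuous_toFun :=
    (continuous_coinduced_dom.2 Circle.exp.continuous : Continuous Real.Angle.toCircle).comp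
      (_root_.continuous_fst (X := Real.Angle) (Y := Real.Angle))

theorem ux_smul (a : ℤˣ) (k : PgTorus) : ux (a • k) = ux k := rfl

/-- The twist of `pg`: `ν(-1, -1) = u_x`, and `ν(a, b) = 1` otherwise. -/
def twist : EquivariantTwist ℤˣ PgTorus where
  val a b := if a = -1 ∧ b = -1 then ux else 1
  cocycle a b c k := by
    rcases Int.units_eq_one_or a with rfl | rfl <;> rcases Int.units_eq_one_or b with rfl | rfl <;>
      rcases Int.units_eq_one_or c with rfl | rfl <;> simp [ux_smul]

/-- The matrix by which `a ∈ {1, -1}` acts from the fibre over `k` of the regular bundle: the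
identity for `a = 1`, and `!![0, exp (i k_x); 1, 0]` for `a = -1`. -/
def regMatrix (a : ℤˣ) (k : PgTorus) : Matrix (Fin 2) (Fin 2) ℂ :=
  if a = -1 then !![0, (ux k : ℂ); 1, 0] else 1

/-- The inverse of `regMatrix a k`. -/
def regMatrixInv (a : ℤˣ) (k : PgTorus) : Matrix (Fin 2) (Fin 2) ℂ :=
  if a = -1 then !![0, 1; ((ux k)⁻¹ : Circle), 0] else 1

theorem regMatrix_mul_inv (a : ℤˣ) (k : PgTorus) : regMatrix a k * regMatrixInv a k = 1 := by
  rcases Int.units_eq_one_or a with rfl | rfl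
  · simp [regMatrix, regMatrixInv]
  · simp [regMatrix, regMatrixInv, Matrix.one_fin_two]

theorem regMatrix_inv_mul (a : ℤˣ) (k : PgTorus) : regMatrixInv a k * regMatrix a k = 1 := by
  rcases Int.units_eq_one_or a with rfl | rfl
  · simp [regMatrix, regMatrixInv]
  · simp [regMatrix, regMatrixInv, Matrix.one_fin_two]

theorem regMatrix_mul (a b : ℤˣ) (k : PgTorus) :
    regMatrix a (b • k) * regMatrix b k =
      (twist.val a b ((a * b) • k) : ℂ) • regMatrix (a * b) k := by
  rcases Int.units_eq_one_or a with rfl | rfl <;> rcases Int.units_eq_one_or b with rfl | rfl <;>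
    simp [regMatrix, twist, ux_smul, Matrix.one_fin_two]

theorem continuous_regMatrix (a : ℤˣ) : Continuous (regMatrix a) := by
  have h : Continuous (fun k : PgTorus ↦ (ux k : ℂ)) := continuous_subtype_val.comp ux.continuous
  refine continuous_matrix fun i j ↦ ?_
  rcases Int.units_eq_one_or a with rfl | rfl
  · simpa [regMatrix] using continuous_const
  · fin_cases i <;> fin_cases j <;> simp [regMatrix, h, continuous_const]

/-- The linear automorphism of `ℂ²` given by `regMatrix a k`. -/
def regEquiv (a : ℤˣ) (k : PgTorus) : (Fin 2 → ℂ) ≃ₗ[ℂ] (Fin 2 → ℂ) where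
  toFun ψ := (regMatrix a k).mulVec ψ
  invFun ψ := (regMatrixInv a k).mulVec ψ
  map_add' := Matrix.mulVec_add (regMatrix a k)
  map_smul' c ψ := Matrix.mulVec_smul (regMatrix a k) c ψ
  left_inv ψ := by
    change (regMatrixInv a k).mulVec ((regMatrix a k).mulVec ψ) = ψ
    rw [Matrix.mulVec_mulVec, regMatrix_inv_mul, Matrix.one_mulVec]
  right_inv ψ := by
    change (regMatrix a k).mulVec ((regMatrixInv a k).mulVec ψ) = ψ
    rw [Matrix.mulVec_mulVec, regMatrix_mul_inv, Matrix.one_mulVec]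

theorem regEquiv_apply (a : ℤˣ) (k : PgTorus) (ψ : Fin 2 → ℂ) :
    regEquiv a k ψ = (regMatrix a k).mulVec ψ :=
  rfl

theorem regEquiv_regEquiv (a b : ℤˣ) (k : PgTorus) (ψ : Fin 2 → ℂ) :
    regEquiv a (b • k) (regEquiv b k ψ) =
      (twist.val a b ((a * b) • k) : ℂ) • regEquiv (a * b) k ψ := by
  simp only [regEquiv_apply]
  rw [Matrix.mulVec_mulVec, regMatrix_mul, Matrix.smul_mulVec]

theorem continuous_regEquiv (a : ℤˣ) :
    Continuous (fun p : PgTorus × (Fin 2 → ℂ) ↦ regEquiv a p.1 p.2) := by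
  simp only [regEquiv_apply]
  exact ((continuous_regMatrix a).comp continuous_fst).matrix_mulVec continuous_snd

theorem continuous_regAction (a : ℤˣ) : Continuous
    (fun p : TotalSpace (Fin 2 → ℂ) (Bundle.Trivial PgTorus (Fin 2 → ℂ)) ↦
      (⟨a • p.1, regEquiv a p.1 p.2⟩ :
        TotalSpace (Fin 2 → ℂ) (Bundle.Trivial PgTorus (Fin 2 → ℂ)))) := by
  have h : Continuous (fun q : PgTorus × (Fin 2 → ℂ) ↦ (a • q.1, regEquiv a q.1 q.2)) :=
    (continuous_fst.const_smul a).prodMk (continuous_regEquiv a)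
  let e := Trivial.homeomorphProd PgTorus (Fin 2 → ℂ)
  exact e.symm.continuous.comp (h.comp e.continuous)

theorem regAction_regAction (a b : ℤˣ) (k : PgTorus) (ψ : Fin 2 → ℂ) :
    (⟨a • b • k, regEquiv a (b • k) (regEquiv b k ψ)⟩ :
      TotalSpace (Fin 2 → ℂ) (Bundle.Trivial PgTorus (Fin 2 → ℂ))) =
      ⟨(a * b) • k, (twist.val a b ((a * b) • k) : ℂ) • regEquiv (a * b) k ψ⟩ :=
  congrArg₂ (fun y (v : Fin 2 → ℂ) ↦
    (⟨y, v⟩ : TotalSpace (Fin 2 → ℂ) (Bundle.Trivial PgTorus (Fin 2 → ℂ))))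
      (mul_smul a b k).symm (regEquiv_regEquiv a b k ψ)

/-- The regular bundle: the product bundle with fibre `ℂ²` and the twisted action
`L (-1) ((k_x, k_y), ψ) = ((k_x, -k_y), !![0, exp (i k_x); 1, 0] ψ)`. -/
def regularBundle : TwistedBundle twist where
  toComplexBundle := ComplexBundle.product PgTorus (Fin 2 → ℂ)
  L := fun a k ↦ regEquiv a k
  continuous_L := continuous_regAction
  L_L := regAction_regAction

end PgTorus

end

/-! Everything follows from one normal form, `PgTorus.exists_standard_frame`: each twisted bundle
has a global frame, indexed by `Fin m ⊕ Fin m`, in which L₋₁ acts by `blockRoot`, the matrix (0, z;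
1, 0) with z = e^{i k_x}. The rank is then 2m, the underlying bundle is trivial, and bundles of
equal rank are isomorphic. Half the rank therefore embeds the monoid of classes in ℤ, hence also its
Grothendieck group, and the regular bundle supplies the value 1.

To find the frame, `ComplexBundle.exists_splitEmbedding` replaces the bundle by a family of
idempotent matrices P, and L₋₁ by a family Λ mapping the fibre over (x, y) to the fibre over (x,
-y), with Λ² = zP. On the two fixed circles y = 0 and y = π, Λ is an endomorphism J with J² = z.
After pulling back along θ ↦ 2θ, J has eigenvalues ±e^{iθ}, and the half turn exchanges the two
eigenbundles. So the bundle is the pushforward of one eigenbundle. That eigenbundle is trivial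
because GL_n(ℂ) is connected, and a frame of it pushes forward to a standard frame
(`Matrix.exists_frame_of_root`). The evenness of the rank comes from here.

Parallel transport across the cylinder 0 ≤ y ≤ π compares the two standard frames and gives a loop
in GL_{2m}(ℂ). The frame at y = 0 may be altered by any loop commuting with `blockRoot`, so only the
homotopy class modulo such loops obstructs. Every loop is homotopic to a power of one diagonal loop
(`ContinuousMap.homotopic_diagLoop_zpow`), and applying the square root of z on a single 2-plane
gives a commuting loop in the class of that generator. The obstruction thus vanishes
(`ContinuousMap.exists_homotopic_commute_blockRoot`), and Λ reflects the frame from the half torus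
to the other half (`Matrix.exists_frame_of_half_frame`). -/

noncomputable section

open Matrix Topology

/-! ### Families of idempotent matrices -/

section Idempotent

variable {ι X : Type*} [Fintype ι] [DecidableEq ι] [TopologicalSpace X]

/-- An invertible complex matrix is joined to `1` by a path of invertible matrices in its double
commutant. -/
theorem Matrix.exists_path_one_of_det_ne_zero (M : Matrix ι ι ℂ) (hM : M.det ≠ 0) :
    ∃ W : ℝ → Matrix ι ι ℂ, Continuous W ∧ W 0 = 1 ∧ W 1 = M ∧ (∀ t, (W t).det ≠ 0) ∧
      ∀ t Q, Commute M Q → Commute (W t) Q := by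
  -- The complex line through 1 and M: its determinant is a polynomial in z, nonzero at 0, so a path
  -- from 0 to 1 can avoid its zeros. Linear combinations of 1 and M commute with all that M
  -- commutes with.
  let L : ℂ → Matrix ι ι ℂ := fun z ↦ (1 - z) • (1 : Matrix ι ι ℂ) + z • M
  let p : Polynomial ℂ :=
    ((1 - Polynomial.X : Polynomial ℂ) • (1 : Matrix ι ι (Polynomial ℂ)) +
      (Polynomial.X : Polynomial ℂ) • M.map Polynomial.C).det
  have hp : ∀ z, p.eval z = (L z).det := by
    intro z
    have := (Polynomial.evalRingHom z).map_det
      ((1 - Polynomial.X : Polynomial ℂ) • (1 : Matrix ι ι (Polynomial ℂ)) +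
        (Polynomial.X : Polynomial ℂ) • M.map Polynomial.C)
    refine this.trans (congrArg _ ?_)
    ext i j
    by_cases h : i = j <;> simp [L, h] <;> ring
  have hp0 : p ≠ 0 := by
    intro h
    have h0 := hp 0
    simp [h, L] at h0
  have hS : {z | (L z).det = 0}.Countable := by
    refine (p.roots.toFinset.finite_toSet.subset fun z hz ↦ ?_).countable
    simpa [hp0, hp] using hz
  have hc := hS.isPathConnected_compl_of_one_lt_rank (by rw [Complex.rank_real_complex]; norm_num)
  obtain ⟨γ, hγ⟩ := hc.joinedIn 0 (by simp [L]) 1 (by simpa [L] using hM)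
  refine ⟨fun t ↦ L (γ.extend t), ?_, by simp [L], by simp [L], fun t ↦ ?_, fun t Q h ↦ ?_⟩
  · have := γ.continuous_extend
    fun_prop
  · exact hγ _
  · exact ((Commute.one_left Q).smul_left _).add_left (h.smul_left _)

/-- The intertwiner between two idempotents. -/
def Matrix.idempotentTransport (p q : Matrix ι ι ℂ) : Matrix ι ι ℂ :=
  q * p + (1 - q) * (1 - p)

theorem Matrix.idempotentTransport_self {p : Matrix ι ι ℂ} (hp : p * p = p) :
    idempotentTransport p p = 1 := by
  simp only [idempotentTransport, mul_sub, sub_mul, hp]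
  simp

/-- Both sides collapse to q p. As the intertwiner is 1 for q = p, it remains invertible for q near
p, which is what lets it serve as a short step of parallel transport. -/
theorem Matrix.idempotentTransport_mul {p q : Matrix ι ι ℂ} (hp : p * p = p) (hq : q * q = q) :
    idempotentTransport p q * p = q * idempotentTransport p q := by
  simp only [idempotentTransport, mul_sub, sub_mul, add_mul, mul_add, mul_assoc, hp]
  simp [← mul_assoc, hq]

/-- Parallel transport along a path of families of idempotents over a compact space. -/
theorem Matrix.exists_transport [CompactSpace X] (P : ℝ → X → Matrix ι ι ℂ)
    (hP : Continuous (Function.uncurry P)) (hPP : ∀ t x, P t x * P t x = P t x) (T : ℝ)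
    (hT : 0 ≤ T) :
    ∃ U : ℝ → X → Matrix ι ι ℂ, Continuous (Function.uncurry U) ∧ (∀ t x, (U t x).det ≠ 0) ∧
      (∀ x, U 0 x = 1) ∧ ∀ t ∈ Set.Icc 0 T, ∀ x, U t x * P 0 x = P t x * U t x := by
  have hPc : ∀ {Y : Type _} [TopologicalSpace Y] (f : Y → ℝ) (g : Y → X), Continuous f →
      Continuous g → Continuous fun y ↦ P (f y) (g y) := fun f g hf hg ↦ hP.comp (hf.prodMk hg)
  let O : Set (ℝ × ℝ) := {a | ∀ x, (idempotentTransport (P a.1 x) (P a.2 x)).det ≠ 0}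
  -- Compactness of X makes the projection along X closed, so invertibility for all x at once is an
  -- open condition on the pair of times.
  have hO : IsOpen O := by
    have h1 : IsOpen {b : (ℝ × ℝ) × X |
        (idempotentTransport (P b.1.1 b.2) (P b.1.2 b.2)).det ≠ 0} := by
      refine isOpen_ne.preimage (Continuous.matrix_det ?_)
      have a1 := hPc (fun b : (ℝ × ℝ) × X ↦ b.1.1) (fun b ↦ b.2) (by fun_prop) (by fun_prop)
      have a2 := hPc (fun b : (ℝ × ℝ) × X ↦ b.1.2) (fun b ↦ b.2) (by fun_prop) (by fun_prop)
      unfold idempotentTransport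
      fun_prop
    have h2 : O = (Prod.fst '' {b : (ℝ × ℝ) × X |
        (idempotentTransport (P b.1.1 b.2) (P b.1.2 b.2)).det ≠ 0}ᶜ)ᶜ := by
      ext a
      simp [O]
    rw [h2, isOpen_compl_iff]
    exact isClosedMap_fst_of_compactSpace _ (isClosed_compl_iff.2 h1)
  have hK : IsCompact ((fun t : ℝ ↦ (t, t)) '' Set.Icc 0 T) :=
    isCompact_Icc.image (by fun_prop)
  obtain ⟨δ, hδ, hδO⟩ := hK.exists_thickening_subset_open hO (by
    rintro _ ⟨t, -, rfl⟩ x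
    simp [idempotentTransport_self (hPP t x)])
  obtain ⟨M, hM⟩ := exists_nat_gt (T / δ)
  have hM0 : (0 : ℝ) < M := lt_of_le_of_lt (by positivity) hM
  have hstep : T / M < δ := by
    rw [div_lt_iff₀ hM0]
    rw [div_lt_iff₀ hδ] at hM
    linarith
  have hstep0 : 0 ≤ T / M := by positivity
  let s : ℕ → ℝ := fun j ↦ j * (T / M)
  have hs : ∀ j, s (j + 1) = s j + T / M := fun j ↦ by simp only [s]; push_cast; ring
  have key : ∀ j ≤ M, ∃ U : ℝ → X → Matrix ι ι ℂ, Continuous (Function.uncurry U) ∧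
      (∀ t x, (U t x).det ≠ 0) ∧ (∀ x, U 0 x = 1) ∧
      ∀ t ≥ 0, ∀ x, U t x * P 0 x = P (min t (s j)) x * U t x := by
    intro j
    induction j with
    | zero =>
      intro _
      refine ⟨fun _ _ ↦ 1, continuous_const, by simp, by simp, fun t ht x ↦ ?_⟩
      simp [s, min_eq_right ht]
    | succ j ih =>
      intro hj
      obtain ⟨U, hU, hd, h0, hi⟩ := ih (by omega)
      have hsj : 0 ≤ s j := by positivity
      have hsj' : s (j + 1) ≤ T := by
        have : s (j + 1) ≤ M * (T / M) := by
          simp only [s]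
          gcongr
        rwa [mul_div_cancel₀ _ hM0.ne'] at this
      -- The times are clamped: up to `s j` the new factor is 1, and afterwards its two times differ
      -- by at most one step, hence by less than δ. This keeps it invertible for every real t.
      refine ⟨fun t x ↦ idempotentTransport (P (min t (s j)) x) (P (min t (s (j + 1))) x) * U t x,
        ?_, fun t x ↦ ?_, fun x ↦ ?_, fun t ht x ↦ ?_⟩
      · have a1 := hPc (fun b : ℝ × X ↦ min b.1 (s j)) (fun b ↦ b.2) (by fun_prop) (by fun_prop)
        have a2 := hPc (fun b : ℝ × X ↦ min b.1 (s (j + 1))) (fun b ↦ b.2)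
          (by fun_prop) (by fun_prop)
        unfold Function.uncurry idempotentTransport
        unfold Function.uncurry at hU
        fun_prop
      · rw [det_mul]
        refine mul_ne_zero ?_ (hd t x)
        rcases le_total t (s j) with h | h
        · rw [min_eq_left h, min_eq_left (by rw [hs]; linarith), idempotentTransport_self (hPP t x)]
          simp
        · rw [min_eq_right h]
          suffices hmem : (s j, min t (s (j + 1))) ∈
              Metric.thickening δ ((fun t : ℝ ↦ (t, t)) '' Set.Icc 0 T) from hδO hmem x
          rw [Metric.mem_thickening_iff]
          refine ⟨_, ⟨s j, ⟨hsj, by linarith [hs j]⟩, rfl⟩, ?_⟩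
          rw [Prod.dist_eq, dist_self, Real.dist_eq]
          refine max_lt hδ (abs_lt.2 ⟨?_, ?_⟩)
          · have : s j ≤ min t (s (j + 1)) := le_min h (by linarith [hs j])
            linarith
          · have := min_le_right t (s (j + 1))
            linarith [hs j]
      · beta_reduce
        rw [h0, min_eq_left hsj, min_eq_left (by linarith [hs j]), mul_one,
          idempotentTransport_self (hPP 0 x)]
      · rw [mul_assoc, hi t ht x, ← mul_assoc, idempotentTransport_mul (hPP _ x) (hPP _ x),
          mul_assoc]
  obtain ⟨U, hU, hd, h0, hi⟩ := key M le_rfl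
  refine ⟨U, hU, hd, h0, fun t ht x ↦ ?_⟩
  have : s M = T := mul_div_cancel₀ _ hM0.ne'
  rw [hi t ht.1 x, this, min_eq_left ht.2]

/-- An idempotent matrix factors through its range. -/
theorem Matrix.exists_factorization_of_idempotent (Q : Matrix ι ι ℂ) (hQ : Q * Q = Q) :
    ∃ (n : ℕ) (f : Matrix ι (Fin n) ℂ) (g : Matrix (Fin n) ι ℂ), g * f = 1 ∧ f * g = Q := by
  let φ := Matrix.toLin' Q
  let b := Module.finBasis ℂ (LinearMap.range φ)
  have hφ : ∀ y ∈ LinearMap.range φ, φ y = y := by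
    rintro _ ⟨x, rfl⟩
    simp [φ, hQ]
  let F : (Fin _ → ℂ) →ₗ[ℂ] (ι → ℂ) := (LinearMap.range φ).subtype ∘ₗ b.equivFun.symm.toLinearMap
  let G : (ι → ℂ) →ₗ[ℂ] (Fin _ → ℂ) := b.equivFun.toLinearMap ∘ₗ φ.rangeRestrict
  refine ⟨_, F.toMatrix', G.toMatrix', ?_, ?_⟩
  · rw [← LinearMap.toMatrix'_comp, ← LinearMap.toMatrix'_id]
    congr 1
    refine LinearMap.ext fun c ↦ ?_
    have : φ.rangeRestrict (b.equivFun.symm c : ι → ℂ) = b.equivFun.symm c :=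
      Subtype.ext (hφ _ (b.equivFun.symm c).2)
    change b.equivFun (φ.rangeRestrict (b.equivFun.symm c : ι → ℂ)) = c
    rw [this, LinearEquiv.apply_symm_apply]
  · rw [← LinearMap.toMatrix'_comp]
    have : F ∘ₗ G = φ := by
      refine LinearMap.ext fun c ↦ ?_
      change ((b.equivFun.symm (b.equivFun (φ.rangeRestrict c)) : LinearMap.range φ) : ι → ℂ) = _
      rw [LinearEquiv.symm_apply_apply]
      rfl
    rw [this, LinearMap.toMatrix'_toLin']

theorem Continuous.matrix_inv_of_det_ne_zero {f : X → Matrix ι ι ℂ} (hf : Continuous f)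
    (h : ∀ x, (f x).det ≠ 0) : Continuous fun x ↦ (f x)⁻¹ := by
  simp only [Matrix.inv_def, Ring.inverse_eq_inv']
  exact (hf.matrix_det.inv₀ h).smul hf.matrix_adjugate

end Idempotent

/-! ### Functions on the circle -/

namespace Real.Angle

instance : CompactSpace Real.Angle :=
  have : Fact (0 < 2 * Real.pi) := ⟨Real.two_pi_pos⟩
  inferInstanceAs (CompactSpace (AddCircle (2 * Real.pi)))

/-- A continuous function on `[0, 2π]` with equal values at the ends descends to the circle. -/
theorem exists_continuous_of_eq_endpoints {Y : Type*} [TopologicalSpace Y] (f : ℝ → Y)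
    (hf : Continuous f) (h : f 0 = f (2 * Real.pi)) :
    ∃ g : Real.Angle → Y, Continuous g ∧ ∀ t ∈ Set.Icc 0 (2 * Real.pi), g t = f t := by
  have : Fact (0 < 2 * Real.pi) := ⟨Real.two_pi_pos⟩
  have h' : f 0 = f (0 + 2 * Real.pi) := by rwa [zero_add]
  refine ⟨AddCircle.liftIco (2 * Real.pi) 0 f,
    AddCircle.liftIco_continuous h' hf.continuousOn, fun t ht ↦ ?_⟩
  rcases ht.2.lt_or_eq with ht2 | rfl
  · exact AddCircle.liftIco_coe_apply (by simpa using ⟨ht.1, ht2⟩)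
  · rw [Real.Angle.coe_two_pi, ← h]
    exact AddCircle.liftIco_coe_apply (by simpa using Real.pi_pos)

theorem exists_coe_eq (θ : Real.Angle) : ∃ t ∈ Set.Icc 0 (2 * Real.pi), (t : Real.Angle) = θ := by
  have : Fact (0 < 2 * Real.pi) := ⟨Real.two_pi_pos⟩
  obtain ⟨t, ht, h⟩ := AddCircle.eq_coe_Ico (p := 2 * Real.pi) θ
  exact ⟨t, ⟨ht.1, ht.2.le⟩, h⟩

theorem two_nsmul_surjective : Function.Surjective fun θ : Real.Angle ↦ (2 : ℕ) • θ := by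
  intro θ
  obtain ⟨t, -, rfl⟩ := exists_coe_eq θ
  refine ⟨(t / 2 : ℝ), ?_⟩
  beta_reduce
  rw [← Real.Angle.natCast_mul_eq_nsmul]
  congr 1
  push_cast
  ring

/-- A continuous function on the circle that is invariant under the half turn factors through
the double covering. -/
theorem exists_continuous_of_add_pi {Y : Type*} [TopologicalSpace Y] (f : Real.Angle → Y)
    (hf : Continuous f) (h : ∀ θ, f (θ + Real.pi) = f θ) :
    ∃ g : Real.Angle → Y, Continuous g ∧ ∀ θ : Real.Angle, g ((2 : ℕ) • θ) = f θ := by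
  have hc : Continuous fun θ : Real.Angle ↦ (2 : ℕ) • θ := by fun_prop
  have hs := two_nsmul_surjective
  -- Doubling is a continuous surjection from a compact to a Hausdorff space, so continuity
  -- downstairs can be tested upstairs, whichever preimage is chosen.
  have hq : IsQuotientMap fun θ : Real.Angle ↦ (2 : ℕ) • θ :=
    hc.isClosedMap.isQuotientMap hc hs
  have hfac : ∀ a b : Real.Angle, (2 : ℕ) • a = (2 : ℕ) • b → f a = f b := by
    intro a b hab
    rcases Real.Angle.two_nsmul_eq_iff.1 hab with rfl | rfl
    · rfl
    · exact h b
  refine ⟨fun θ ↦ f (Function.surjInv hs θ), ?_, fun θ ↦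
    hfac _ _ (Function.surjInv_eq hs _)⟩
  rw [hq.continuous_iff]
  exact hf.congr fun θ ↦ (hfac _ _ (Function.surjInv_eq hs ((2 : ℕ) • θ))).symm

end Real.Angle

/-- A loop of idempotent matrices splits: its range is a trivial bundle. -/
theorem Matrix.exists_factorization_of_idempotent_loop {ι : Type*} [Fintype ι] [DecidableEq ι]
    (Q : Real.Angle → Matrix ι ι ℂ) (hQ : Continuous Q) (hQQ : ∀ θ, Q θ * Q θ = Q θ) :
    ∃ (n : ℕ) (f : Real.Angle → Matrix ι (Fin n) ℂ) (g : Real.Angle → Matrix (Fin n) ι ℂ),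
      Continuous f ∧ Continuous g ∧ (∀ θ, g θ * f θ = 1) ∧ ∀ θ, f θ * g θ = Q θ := by
  have hpi := Real.two_pi_pos
  obtain ⟨U, hU, hUd, hU0, hUi⟩ := Matrix.exists_transport
    (fun (t : ℝ) (_ : Unit) ↦ Q t) (hQ.comp (Real.Angle.continuous_coe.comp continuous_fst))
    (fun t _ ↦ hQQ t) (2 * Real.pi) hpi.le
  obtain ⟨W, hW, hW0, hW1, hWd, hWc⟩ :=
    Matrix.exists_path_one_of_det_ne_zero (U (2 * Real.pi) ()) (hUd _ _)
  obtain ⟨n, f₀, g₀, hgf, hfg⟩ := Matrix.exists_factorization_of_idempotent (Q 0) (hQQ 0)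
  -- The monodromy `U (2π)` commutes with `Q 0`, and the path W stays in its double commutant.
  have hWQ : ∀ t, W t * Q 0 = Q 0 * W t := by
    intro t
    refine hWc t (Q 0) ?_
    have := hUi (2 * Real.pi) ⟨hpi.le, le_rfl⟩ ()
    simpa [Commute, SemiconjBy] using this
  -- Dividing by W undoes the monodromy gradually: A equals 1 at both ends and still conjugates `Q
  -- 0` to `Q t`.
  let A : ℝ → Matrix ι ι ℂ := fun t ↦ U t () * (W (t / (2 * Real.pi)))⁻¹
  let A' : ℝ → Matrix ι ι ℂ := fun t ↦ W (t / (2 * Real.pi)) * (U t ())⁻¹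
  have hUc : Continuous fun t ↦ U t () := hU.comp (by fun_prop : Continuous fun t : ℝ ↦ (t, ()))
  have hWc' : Continuous fun t : ℝ ↦ W (t / (2 * Real.pi)) := hW.comp (by fun_prop)
  have hA : Continuous A := hUc.mul (hWc'.matrix_inv_of_det_ne_zero fun t ↦ hWd _)
  have hA' : Continuous A' := hWc'.mul (hUc.matrix_inv_of_det_ne_zero fun t ↦ hUd _ _)
  have uW : ∀ t, IsUnit (W t).det := fun t ↦ (hWd t).isUnit
  have uU : ∀ t, IsUnit (U t ()).det := fun t ↦ (hUd t ()).isUnit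
  have hA0 : A 0 = 1 := by simp [A, hU0, hW0]
  have hA0' : A' 0 = 1 := by simp [A', hU0, hW0]
  have hA1 : A (2 * Real.pi) = 1 := by
    simp only [A]
    rw [div_self hpi.ne', hW1, mul_nonsing_inv _ (uU _)]
  have hA1' : A' (2 * Real.pi) = 1 := by
    simp only [A']
    rw [div_self hpi.ne', hW1, mul_nonsing_inv _ (uU _)]
  have hAA : ∀ t, A' t * A t = 1 := by
    intro t
    simp only [A, A']
    rw [mul_assoc, ← mul_assoc _ (U t ()), nonsing_inv_mul _ (uU _), one_mul,
      mul_nonsing_inv _ (uW _)]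
  have hAQ : ∀ t ∈ Set.Icc 0 (2 * Real.pi), A t * Q 0 * A' t = Q t := by
    intro t ht
    have h1 : (W (t / (2 * Real.pi)))⁻¹ * Q 0 * W (t / (2 * Real.pi)) = Q 0 := by
      rw [mul_assoc, ← hWQ, ← mul_assoc, nonsing_inv_mul _ (uW _), one_mul]
    have h2 := hUi t ht ()
    simp only [Real.Angle.coe_zero] at h2
    calc A t * Q 0 * A' t = U t () * ((W (t / (2 * Real.pi)))⁻¹ * Q 0 * W (t / (2 * Real.pi)))
          * (U t ())⁻¹ := by simp only [A, A', mul_assoc]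
      _ = Q t := by rw [h1, h2, mul_assoc, mul_nonsing_inv _ (uU _), mul_one]
  obtain ⟨f, hf, hf'⟩ := Real.Angle.exists_continuous_of_eq_endpoints (fun t ↦ A t * f₀)
    (hA.matrix_mul continuous_const) (by simp only [hA0, hA1])
  obtain ⟨g, hg, hg'⟩ := Real.Angle.exists_continuous_of_eq_endpoints (fun t ↦ g₀ * A' t)
    (continuous_const.matrix_mul hA') (by simp only [hA0', hA1'])
  refine ⟨n, f, g, hf, hg, fun θ ↦ ?_, fun θ ↦ ?_⟩
  · obtain ⟨t, ht, rfl⟩ := Real.Angle.exists_coe_eq θ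
    rw [hf' t ht, hg' t ht, Matrix.mul_assoc, ← Matrix.mul_assoc _ _ f₀, hAA, Matrix.one_mul, hgf]
  · obtain ⟨t, ht, rfl⟩ := Real.Angle.exists_coe_eq θ
    rw [hf' t ht, hg' t ht, Matrix.mul_assoc, ← Matrix.mul_assoc f₀, hfg, ← Matrix.mul_assoc,
      hAQ t ht]

/-! ### Square roots of the coordinate function on bundles over the circle -/

section SquareRoot

variable {κ n : Type*} [Fintype κ] [DecidableEq κ] [Fintype n] [DecidableEq n]

/-- The block matrix `!![0, z; 1, 0]`, a square root of `z`. -/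
def Matrix.blockRoot (n : Type*) [DecidableEq n] (z : ℂ) : Matrix (n ⊕ n) (n ⊕ n) ℂ :=
  fromBlocks 0 (z • (1 : Matrix n n ℂ)) 1 0

theorem Matrix.blockRoot_mul_self (z : ℂ) : blockRoot n z * blockRoot n z = z • 1 := by
  simp [blockRoot, fromBlocks_multiply, ← fromBlocks_one, fromBlocks_smul]

/-- The projection onto the eigenspace of a square root `J` of `e ^ 2` for the eigenvalue `e`. -/
def Matrix.rootProjection {κ : Type*} (P J : Matrix κ κ ℂ) (e : ℂ) : Matrix κ κ ℂ :=
  (2⁻¹ : ℂ) • (P + e⁻¹ • J)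

theorem Matrix.rootProjection_mul_self {P J : Matrix κ κ ℂ} {e : ℂ} (he : e ≠ 0)
    (hPP : P * P = P) (hJP : J * P = J) (hPJ : P * J = J) (hJJ : J * J = (e ^ 2) • P) :
    rootProjection P J e * rootProjection P J e = rootProjection P J e := by
  simp only [rootProjection, smul_mul_assoc, mul_smul_comm, mul_add, add_mul, hPP, hJP, hPJ, hJJ,
    smul_add, smul_smul]
  match_scalars <;> field_simp <;> norm_num

theorem Matrix.rootProjection_mul_neg {P J : Matrix κ κ ℂ} {e : ℂ} (he : e ≠ 0)
    (hPP : P * P = P) (hJP : J * P = J) (hPJ : P * J = J) (hJJ : J * J = (e ^ 2) • P) :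
    rootProjection P J e * rootProjection P J (-e) = 0 := by
  simp only [rootProjection, smul_mul_assoc, mul_smul_comm, mul_add, add_mul, hPP, hJP, hPJ, hJJ,
    smul_add, smul_smul]
  match_scalars <;> field_simp <;> norm_num

theorem Matrix.mul_rootProjection {P J : Matrix κ κ ℂ} {e : ℂ} (he : e ≠ 0)
    (hJP : J * P = J) (hJJ : J * J = (e ^ 2) • P) :
    J * rootProjection P J e = e • rootProjection P J e := by
  simp only [rootProjection, mul_smul_comm, mul_add, hJP, hJJ, smul_add, smul_smul]
  match_scalars <;> field_simp

theorem Matrix.rootProjection_add_neg {κ : Type*} {P J : Matrix κ κ ℂ} {e : ℂ} :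
    rootProjection P J e + rootProjection P J (-e) = P := by
  simp only [rootProjection, inv_neg]
  module

/-- The frame obtained by pushing a frame of the eigenbundle forward along the double covering. -/
def Matrix.pushFrame (e : ℂ) (f f' : Matrix κ n ℂ) : Matrix κ (n ⊕ n) ℂ :=
  fromCols (f + f') (e • (f - f'))

/-- The coordinates with respect to `pushFrame`. -/
def Matrix.pushCoframe (e : ℂ) (g g' : Matrix n κ ℂ) : Matrix (n ⊕ n) κ ℂ :=
  fromRows ((2⁻¹ : ℂ) • (g + g')) ((2⁻¹ * e⁻¹) • (g - g'))

theorem Matrix.pushCoframe_mul_pushFrame {κ n : Type*} [Fintype κ] [DecidableEq n] {e : ℂ}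
    {f f' : Matrix κ n ℂ} {g g' : Matrix n κ ℂ} (he : e ≠ 0) (h : g * f = 1) (h' : g' * f' = 1)
    (h₁ : g * f' = 0) (h₂ : g' * f = 0) : pushCoframe e g g' * pushFrame e f f' = 1 := by
  rw [pushCoframe, pushFrame, fromRows_mul_fromCols, ← fromBlocks_one]
  simp only [Matrix.smul_mul, Matrix.mul_smul, Matrix.mul_add, Matrix.add_mul, Matrix.sub_mul,
    Matrix.mul_sub, h, h', h₁, h₂]
  congr 1
  · match_scalars; norm_num
  · match_scalars; norm_num
  · match_scalars; norm_num
  · match_scalars; field_simp; norm_num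

theorem Matrix.pushFrame_mul_pushCoframe {κ n : Type*} [Fintype n] {e : ℂ}
    {f f' : Matrix κ n ℂ} {g g' : Matrix n κ ℂ} (he : e ≠ 0) :
    pushFrame e f f' * pushCoframe e g g' = f * g + f' * g' := by
  rw [pushCoframe, pushFrame, fromCols_mul_fromRows]
  simp only [Matrix.smul_mul, Matrix.mul_smul, Matrix.mul_add, Matrix.add_mul, Matrix.sub_mul,
    Matrix.mul_sub]
  match_scalars <;> field_simp <;> norm_num

/-- J sends the first block f + f' to e(f - f'), which is the second block, and the second block to
e² times the first. -/
theorem Matrix.mul_pushFrame {κ n : Type*} [Fintype κ] [Fintype n] [DecidableEq n]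
    {J : Matrix κ κ ℂ} {e : ℂ} {f f' : Matrix κ n ℂ} (h : J * f = e • f) (h' : J * f' = (-e) • f') :
    J * pushFrame e f f' = pushFrame e f f' * blockRoot n (e ^ 2) := by
  rw [pushFrame, blockRoot, fromCols_mul_fromBlocks, mul_fromCols]
  simp only [Matrix.mul_smul, Matrix.mul_add, Matrix.mul_sub, h, h', Matrix.mul_zero,
    Matrix.mul_one, zero_add, add_zero]
  congr 1 <;> module

/-- The half turn replaces e by -e and swaps f with f'. Invariance under this change lets the frame
descend along the double covering. -/
theorem Matrix.pushFrame_neg {κ n : Type*} {e : ℂ} {f f' : Matrix κ n ℂ} :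
    pushFrame (-e) f' f = pushFrame e f f' := by
  rw [pushFrame, pushFrame]
  congr 1 <;> module

theorem Matrix.pushCoframe_neg {κ n : Type*} {e : ℂ} {g g' : Matrix n κ ℂ} :
    pushCoframe (-e) g' g = pushCoframe e g g' := by
  rw [pushCoframe, pushCoframe]
  congr 1
  · module
  · rw [inv_neg]; module

theorem Continuous.matrix_fromCols {Y l m p : Type*} [TopologicalSpace Y]
    {A : Y → Matrix l m ℂ} {B : Y → Matrix l p ℂ} (hA : Continuous A) (hB : Continuous B) :
    Continuous fun y ↦ fromCols (A y) (B y) :=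
  continuous_matrix fun i j ↦ by
    rcases j with j | j
    · exact hA.matrix_elem i j
    · exact hB.matrix_elem i j

theorem Continuous.matrix_fromRows {Y l m p : Type*} [TopologicalSpace Y]
    {A : Y → Matrix m l ℂ} {B : Y → Matrix p l ℂ} (hA : Continuous A) (hB : Continuous B) :
    Continuous fun y ↦ fromRows (A y) (B y) :=
  continuous_matrix fun i j ↦ by
    rcases i with i | i
    · exact hA.matrix_elem i j
    · exact hB.matrix_elem i j

theorem Real.Angle.continuous_toCircle : Continuous Real.Angle.toCircle :=
  (continuous_coinduced_dom.2 Circle.exp.continuous : Continuous Real.Angle.toCircle)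

theorem Real.Angle.continuous_coe_toCircle :
    Continuous fun x : Real.Angle ↦ (x.toCircle : ℂ) :=
  continuous_subtype_val.comp Real.Angle.continuous_toCircle

/-- A bundle over the circle with a square root of the coordinate function has a frame in which
the square root is the standard one. -/
theorem Matrix.exists_frame_of_root (P J : Real.Angle → Matrix κ κ ℂ) (hP : Continuous P)
    (hJ : Continuous J) (hPP : ∀ x, P x * P x = P x) (hJP : ∀ x, J x * P x = J x)
    (hJJ : ∀ x, J x * J x = (x.toCircle : ℂ) • P x) :
    ∃ (m : ℕ) (F : Real.Angle → Matrix κ (Fin m ⊕ Fin m) ℂ)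
      (G : Real.Angle → Matrix (Fin m ⊕ Fin m) κ ℂ), Continuous F ∧ Continuous G ∧
      (∀ x, G x * F x = 1) ∧ (∀ x, F x * G x = P x) ∧
      ∀ x, J x * F x = F x * blockRoot (Fin m) x.toCircle := by
  -- Evaluate J³ in two ways, as (zP)J and as J(zP) = zJ, and cancel z.
  have hPJ : ∀ x, P x * J x = J x := fun x ↦ by
    have h1 : (x.toCircle : ℂ) • (P x * J x) = (x.toCircle : ℂ) • J x := by
      rw [← smul_mul_assoc, ← hJJ, mul_assoc, hJJ, mul_smul_comm, hJP]
    exact smul_right_injective _ (Circle.coe_ne_zero _) h1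
  let e : Real.Angle → ℂ := fun θ ↦ θ.toCircle
  have he : ∀ θ, e θ ≠ 0 := fun θ ↦ Circle.coe_ne_zero _
  have he2 : ∀ θ : Real.Angle, (((2 : ℕ) • θ).toCircle : ℂ) = e θ ^ 2 := fun θ ↦ by
    rw [two_nsmul, Real.Angle.toCircle_add, Circle.coe_mul, sq]
  have heπ : ∀ θ : Real.Angle, e (θ + Real.pi) = -e θ := fun θ ↦ by
    simp [e, Real.Angle.toCircle_add]
  have h2π : ∀ θ : Real.Angle, (2 : ℕ) • (θ + Real.pi) = (2 : ℕ) • θ := fun θ ↦ by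
    rw [nsmul_add]; simp
  have hππ : ∀ θ : Real.Angle, θ + Real.pi + Real.pi = θ := fun θ ↦ by
    rw [add_assoc]; simp
  have hec : Continuous e := Real.Angle.continuous_coe_toCircle
  let Q : Real.Angle → Matrix κ κ ℂ := fun θ ↦
    rootProjection (P ((2 : ℕ) • θ)) (J ((2 : ℕ) • θ)) (e θ)
  have hQπ : ∀ θ, Q (θ + Real.pi) =
      rootProjection (P ((2 : ℕ) • θ)) (J ((2 : ℕ) • θ)) (-e θ) := fun θ ↦ by
    simp only [Q, h2π, heπ]
  have hQc : Continuous Q := by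
    have h1 : Continuous fun θ ↦ (e θ)⁻¹ := hec.inv₀ he
    have h2 : Continuous fun θ : Real.Angle ↦ P ((2 : ℕ) • θ) := hP.comp (by fun_prop)
    have h3 : Continuous fun θ : Real.Angle ↦ J ((2 : ℕ) • θ) := hJ.comp (by fun_prop)
    exact (h2.add (h1.smul h3)).const_smul (2⁻¹ : ℂ)
  have hJ2 : ∀ θ : Real.Angle,
      J ((2 : ℕ) • θ) * J ((2 : ℕ) • θ) = (e θ ^ 2) • P ((2 : ℕ) • θ) := fun θ ↦ by
    rw [hJJ, he2]
  obtain ⟨m, f, g, hf, hg, hgf, hfg⟩ := exists_factorization_of_idempotent_loop Q hQc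
    fun θ ↦ rootProjection_mul_self (he θ) (hPP _) (hJP _) (hPJ _) (hJ2 θ)
  have hQQ : ∀ θ, Q θ * Q (θ + Real.pi) = 0 := fun θ ↦ by
    rw [hQπ]
    exact rootProjection_mul_neg (he θ) (hPP _) (hJP _) (hPJ _) (hJ2 θ)
  -- Inserting gf = 1 on both sides brings out the product of the two complementary
  -- eigenprojections, which is zero.
  have hgf' : ∀ θ, g θ * f (θ + Real.pi) = 0 := fun θ ↦ by
    calc g θ * f (θ + Real.pi)
        = (g θ * f θ) * g θ * (f (θ + Real.pi) * (g (θ + Real.pi) * f (θ + Real.pi))) := by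
          rw [hgf, hgf, Matrix.one_mul, Matrix.mul_one]
      _ = g θ * ((f θ * g θ) * (f (θ + Real.pi) * g (θ + Real.pi))) * f (θ + Real.pi) := by
          simp only [Matrix.mul_assoc]
      _ = 0 := by rw [hfg, hfg, hQQ, Matrix.mul_zero, Matrix.zero_mul]
  have hJf : ∀ θ, J ((2 : ℕ) • θ) * f θ = e θ • f θ := fun θ ↦ by
    calc J ((2 : ℕ) • θ) * f θ = J ((2 : ℕ) • θ) * (f θ * g θ) * f θ := by
          rw [Matrix.mul_assoc, Matrix.mul_assoc, hgf, Matrix.mul_one]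
      _ = e θ • f θ := by
          rw [hfg, mul_rootProjection (he θ) (hJP _) (hJ2 θ)]
          change (e θ • Q θ) * f θ = _
          rw [← hfg, Matrix.smul_mul, Matrix.mul_assoc, hgf, Matrix.mul_one]
  have hcπ : Continuous fun θ : Real.Angle ↦ θ + Real.pi := by fun_prop
  obtain ⟨F, hF, hF'⟩ := Real.Angle.exists_continuous_of_add_pi
    (fun θ ↦ pushFrame (e θ) (f θ) (f (θ + Real.pi)))
    ((hf.add (hf.comp hcπ)).matrix_fromCols (hec.smul (hf.sub (hf.comp hcπ))))
    (fun θ ↦ by rw [hππ, heπ, pushFrame_neg])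
  obtain ⟨G, hG, hG'⟩ := Real.Angle.exists_continuous_of_add_pi
    (fun θ ↦ pushCoframe (e θ) (g θ) (g (θ + Real.pi)))
    ((Continuous.const_smul (hg.add (hg.comp hcπ)) (2⁻¹ : ℂ)).matrix_fromRows
      (((hec.inv₀ he).const_mul (2⁻¹ : ℂ)).smul (hg.sub (hg.comp hcπ))))
    (fun θ ↦ by rw [hππ, heπ, pushCoframe_neg])
  refine ⟨m, F, G, hF, hG, fun x ↦ ?_, fun x ↦ ?_, fun x ↦ ?_⟩ <;>
    obtain ⟨θ, rfl⟩ := Real.Angle.two_nsmul_surjective x <;> beta_reduce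
  · rw [hF', hG']
    refine pushCoframe_mul_pushFrame (he θ) (hgf _) (hgf _) (hgf' _) ?_
    simpa only [hππ] using hgf' (θ + Real.pi)
  · rw [hF', hG', pushFrame_mul_pushCoframe (he θ), hfg, hfg, hQπ]
    exact rootProjection_add_neg
  · rw [hF', he2]
    refine mul_pushFrame (hJf θ) ?_
    simpa only [h2π, heπ] using hJf (θ + Real.pi)

end SquareRoot

/-! ### Loops of invertible matrices -/

section HomotopyGL

variable {ι X : Type*} [Fintype ι] [DecidableEq ι] [TopologicalSpace X]

/-- A continuous family of matrices with nonzero determinant as a continuous map to the general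
linear group. -/
def ContinuousMap.mkGL (f : X → Matrix ι ι ℂ) (hf : Continuous f) (hd : ∀ x, (f x).det ≠ 0) :
    C(X, GL ι ℂ) where
  toFun x := GeneralLinearGroup.mkOfDetNeZero (f x) (hd x)
  continuous_toFun := by
    refine Units.continuous_iff.2 ⟨hf, ?_⟩
    refine (hf.matrix_inv_of_det_ne_zero hd).congr fun x ↦ ?_
    rw [Matrix.coe_units_inv]
    rfl

@[simp]
theorem ContinuousMap.coe_mkGL (f : X → Matrix ι ι ℂ) (hf : Continuous f)
    (hd : ∀ x, (f x).det ≠ 0) (x : X) : (ContinuousMap.mkGL f hf hd x : Matrix ι ι ℂ) = f x :=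
  rfl

theorem Matrix.GeneralLinearGroup.det_coe_ne_zero (g : GL ι ℂ) : (g : Matrix ι ι ℂ).det ≠ 0 :=
  g.isUnit.map (Matrix.detMonoidHom) |>.ne_zero

namespace ContinuousMap

theorem continuous_coe_GL (g : C(X, GL ι ℂ)) : Continuous fun x ↦ (g x : Matrix ι ι ℂ) :=
  Units.continuous_val.comp g.continuous

theorem homotopic_GL_of_path {g g' : C(X, GL ι ℂ)} (H : ℝ → X → Matrix ι ι ℂ)
    (hH : Continuous (Function.uncurry H)) (hd : ∀ s ∈ Set.Icc (0 : ℝ) 1, ∀ x, (H s x).det ≠ 0)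
    (h0 : ∀ x, H 0 x = g x) (h1 : ∀ x, H 1 x = g' x) : g.Homotopic g' := by
  refine ⟨⟨mkGL (fun p : unitInterval × X ↦ H p.1 p.2) ?_ fun p ↦ hd _ p.1.2 _, ?_, ?_⟩⟩
  · exact hH.comp (by fun_prop : Continuous fun p : unitInterval × X ↦ ((p.1 : ℝ), p.2))
  · exact fun x ↦ Units.ext (h0 x)
  · exact fun x ↦ Units.ext (h1 x)

theorem Homotopic.mul_congr {Y : Type*} [TopologicalSpace Y] [Mul Y] [ContinuousMul Y]
    {f f' g g' : C(X, Y)} (hf : f.Homotopic f') (hg : g.Homotopic g') :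
    (f * g).Homotopic (f' * g') :=
  Homotopic.comp (Homotopic.refl (⟨fun p : Y × Y ↦ p.1 * p.2, continuous_mul⟩ : C(Y × Y, Y)))
    (hf.prodMk hg)

theorem Homotopic.zpow_congr {Y : Type*} [TopologicalSpace Y] [Group Y] [IsTopologicalGroup Y]
    {f f' : C(X, Y)} (hf : f.Homotopic f') (d : ℤ) : (f ^ d).Homotopic (f' ^ d) :=
  Homotopic.comp (Homotopic.refl (⟨fun p : Y ↦ p ^ d, continuous_zpow d⟩ : C(Y, Y))) hf

/-- This is the path-connectedness of GL_n(ℂ). -/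
theorem homotopic_const_one (M : GL ι ℂ) : (const X M).Homotopic 1 := by
  obtain ⟨W, hW, hW0, hW1, hWd, -⟩ :=
    Matrix.exists_path_one_of_det_ne_zero (M : Matrix ι ι ℂ) M.det_coe_ne_zero
  refine Homotopic.symm (homotopic_GL_of_path (fun s _ ↦ W s) (hW.comp continuous_fst)
    (fun s _ _ ↦ hWd s) (fun x ↦ ?_) (fun x ↦ ?_))
  · simp [hW0]
  · simp [hW1]

/-- Two continuous maps to the general linear group that differ by a constant are homotopic. -/
theorem homotopic_const_mul (M : GL ι ℂ) (g : C(X, GL ι ℂ)) : (const X M * g).Homotopic g := by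
  simpa using (homotopic_const_one M).mul_congr (Homotopic.refl g)

end ContinuousMap

/-- A vector-valued function on the circle can be approximated by continuously differentiable
ones. -/
theorem Real.Angle.exists_contDiff_approx {ι : Type*} [Fintype ι]
    (v : Real.Angle → ι → ℂ) (hv : Continuous v) {ε : ℝ} (hε : 0 < ε) :
    ∃ v' : Real.Angle → ι → ℂ, Continuous v' ∧
      ContDiff ℝ 1 (fun t : ℝ ↦ v' t) ∧ ∀ x, dist (v x) (v' x) < ε := by
  have : Fact (0 < 2 * Real.pi) := ⟨Real.two_pi_pos⟩
  have key : ∀ i, ∃ f : C(AddCircle (2 * Real.pi), ℂ),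
      ContDiff ℝ 1 (fun t : ℝ ↦ f t) ∧ ∀ x : AddCircle (2 * Real.pi), dist (v x i) (f x) < ε := by
    intro i
    let vi : C(AddCircle (2 * Real.pi), ℂ) := ⟨fun x ↦ v x i, (continuous_apply i).comp hv⟩
    -- Trigonometric polynomials are uniformly dense and smooth, so each coordinate can be
    -- approximated by one.
    have hmem : vi ∈
        (Submodule.span ℂ (Set.range (@fourier (2 * Real.pi)))).topologicalClosure := by
      rw [span_fourier_closure_eq_top]; trivial
    obtain ⟨f, hf, hd⟩ := Metric.mem_closure_iff.1 hmem ε hε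
    refine ⟨f, ?_, fun x ↦ (ContinuousMap.dist_apply_le_dist x).trans_lt hd⟩
    have hf' : f ∈ Submodule.span ℂ (Set.range (@fourier (2 * Real.pi))) := hf
    clear hf hd
    induction hf' using Submodule.span_induction with
    | mem f hf =>
      obtain ⟨n, rfl⟩ := hf
      have h : (fun t : ℝ ↦ fourier (T := 2 * Real.pi) n t) =
          fun t : ℝ ↦ Complex.exp (2 * Real.pi * Complex.I * n * t / (2 * Real.pi : ℝ)) := by
        ext t
        exact fourier_coe_apply
      rw [h]
      have h2 : ContDiff ℝ 1 fun t : ℝ ↦ (t : ℂ) := Complex.ofRealCLM.contDiff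
      exact ((contDiff_const.mul h2).div_const _).cexp
    | zero => exact contDiff_const
    | add f g _ _ hf hg => exact ContDiff.add hf hg
    | smul c f _ hf => exact contDiff_const.mul hf
  choose f hf hd using key
  refine ⟨fun x i ↦ f i x, continuous_pi fun i ↦ (f i).continuous, contDiff_pi.2 hf, fun x ↦ ?_⟩
  exact (dist_pi_lt_iff hε).2 fun i ↦ hd i x

/-- General position: a continuously differentiable loop in `ℂ ^ n` with `2 ≤ n` misses the line
through some vector. -/
theorem Real.Angle.exists_forall_ne_smul {ι : Type*} [Fintype ι]
    (hι : 1 < Fintype.card ι) (v : Real.Angle → ι → ℂ) (hv : ContDiff ℝ 1 (fun t : ℝ ↦ v t)) :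
    ∃ w : ι → ℂ, ∀ x (c : ℂ), w ≠ c • v x := by
  have h : ContDiff ℝ 1 (fun p : ℝ × ℂ ↦ p.2 • v p.1) :=
    contDiff_snd.smul (hv.comp contDiff_fst)
  have hd : Dense (Set.range (fun p : ℝ × ℂ ↦ p.2 • v p.1))ᶜ := by
    -- The source ℝ × ℂ has real dimension 3, while ℂⁿ with n ≥ 2 has real dimension at least 4.
    -- This is why the loop had to be made C¹.
    refine h.dense_compl_range_of_finrank_lt_finrank ?_
    rw [Module.finrank_prod, Module.finrank_pi_fintype]
    simp only [Module.finrank_self, Complex.finrank_real_complex, Finset.sum_const,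
      Finset.card_univ, smul_eq_mul]
    omega
  obtain ⟨w, hw⟩ := hd.nonempty
  refine ⟨w, fun x c hwc ↦ hw ?_⟩
  obtain ⟨t, -, rfl⟩ := Real.Angle.exists_coe_eq x
  exact ⟨(t, c), hwc.symm⟩

open ComplexOrder in
/-- A continuous family of functionals taking the value `1` both on `v x` and on `w`. -/
theorem Matrix.exists_functional {ι X : Type*} [Fintype ι] [TopologicalSpace X]
    (v : X → ι → ℂ) (hv : Continuous v) (hv0 : ∀ x, v x ≠ 0) (w : ι → ℂ)
    (hw : ∀ x (c : ℂ), w ≠ c • v x) :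
    ∃ α : X → ι → ℂ, Continuous α ∧ (∀ x, α x ⬝ᵥ v x = 1) ∧ ∀ x, α x ⬝ᵥ w = 1 := by
  let d : X → ℂ := fun x ↦ star (v x) ⬝ᵥ v x
  have hd : ∀ x, d x ≠ 0 := fun x h ↦ hv0 x (dotProduct_star_self_eq_zero.1 h)
  -- The component of w orthogonal to `v x`, nonzero because w lies off the line. The functional is
  -- then prescribed independently along `v x` and `u x`.
  let u : X → ι → ℂ := fun x ↦ w - ((d x)⁻¹ * (star (v x) ⬝ᵥ w)) • v x
  have hu0 : ∀ x, star (u x) ⬝ᵥ u x ≠ 0 := fun x h ↦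
    hw x _ (sub_eq_zero.1 (dotProduct_star_self_eq_zero.1 h))
  have huv : ∀ x, star (v x) ⬝ᵥ u x = 0 := fun x ↦ by
    simp only [u, dotProduct_sub, dotProduct_smul, smul_eq_mul]
    change _ - _ * d x = 0
    field_simp [hd x]
    ring
  have hvu : ∀ x, star (u x) ⬝ᵥ v x = 0 := fun x ↦ by
    rw [star_dotProduct, huv, star_zero]
  have huw : ∀ x, star (u x) ⬝ᵥ w = star (u x) ⬝ᵥ u x := fun x ↦ by
    simp only [u, dotProduct_sub, dotProduct_smul, smul_eq_mul]
    have := hvu x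
    simp only [u] at this
    rw [this, mul_zero, sub_zero]
  have hdc : Continuous d := hv.star.dotProduct hv
  have huc : Continuous u := continuous_const.sub
    (((hdc.inv₀ hd).mul (hv.star.dotProduct continuous_const)).smul hv)
  refine ⟨fun x ↦ (d x)⁻¹ • star (v x) +
    ((1 - (d x)⁻¹ * (star (v x) ⬝ᵥ w)) * (star (u x) ⬝ᵥ u x)⁻¹) • star (u x), ?_, fun x ↦ ?_,
    fun x ↦ ?_⟩
  · have h1 : Continuous fun x ↦ (star (u x) ⬝ᵥ u x)⁻¹ := (huc.star.dotProduct huc).inv₀ hu0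
    have h2 : Continuous fun x ↦ (star (v x) ⬝ᵥ w) := hv.star.dotProduct continuous_const
    exact ((hdc.inv₀ hd).smul hv.star).add
      (((continuous_const.sub ((hdc.inv₀ hd).mul h2)).mul h1).smul huc.star)
  · rw [add_dotProduct, smul_dotProduct, smul_dotProduct, hvu, smul_zero, add_zero, smul_eq_mul]
    exact inv_mul_cancel₀ (hd x)
  · rw [add_dotProduct, smul_dotProduct, smul_dotProduct, huw, smul_eq_mul, smul_eq_mul, mul_assoc,
      inv_mul_cancel₀ (hu0 x)]
    ring

/-- The rank-one matrix squares to zero, so changing its sign gives the inverse of the transvection.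
-/
theorem Matrix.det_one_add_vecMulVec_ne_zero (a α : ι → ℂ) (h : α ⬝ᵥ a = 0) :
    (1 + vecMulVec a α).det ≠ 0 := by
  have : (1 + vecMulVec a α) * (1 - vecMulVec a α) = 1 := by
    rw [mul_sub, mul_one, add_mul, one_mul, vecMulVec_mul_vecMulVec, h]
    simp [vecMulVec_zero]
  intro h0
  have := congrArg det this
  rw [det_mul, h0] at this
  simp at this

namespace ContinuousMap

/-- A column of a loop of invertible matrices can be made continuously differentiable by a
homotopy. -/
theorem exists_homotopic_contDiff_col (g : C(Real.Angle, GL ι ℂ)) (i : ι) :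
    ∃ g' : C(Real.Angle, GL ι ℂ), g.Homotopic g' ∧
      ContDiff ℝ 1 (fun t : ℝ ↦ (g' t : Matrix ι ι ℂ).col i) := by
  have hg := g.continuous_coe_GL
  let v : Real.Angle → ι → ℂ := fun x ↦ (g x : Matrix ι ι ℂ).col i
  have hv : Continuous v := continuous_pi fun j ↦ hg.matrix_elem j i
  let D : Real.Angle × (ι → ℂ) → ℂ := fun p ↦ ((g p.1 : Matrix ι ι ℂ).updateCol i (v p.1 + p.2)).det
  have hD : Continuous D := by
    refine ((hg.comp continuous_fst).matrix_updateCol i ?_).matrix_det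
    exact (hv.comp continuous_fst).add continuous_snd
  -- Compactness of the circle gives one radius ε for which every perturbation of the column smaller
  -- than ε keeps the matrix invertible at every x.
  have hO : IsOpen {w : ι → ℂ | ∀ x, D (x, w) ≠ 0} := by
    have h2 : {w : ι → ℂ | ∀ x, D (x, w) ≠ 0} = (Prod.snd '' {p | D p ≠ 0}ᶜ)ᶜ := by
      ext a
      simp
    rw [h2, isOpen_compl_iff]
    exact isClosedMap_snd_of_compactSpace _ (isClosed_compl_iff.2 (isOpen_ne.preimage hD))
  obtain ⟨ε, hε, hεO⟩ := Metric.isOpen_iff.1 hO 0 (fun x ↦ by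
    have : (g x : Matrix ι ι ℂ).updateCol i (v x + 0) = g x := by
      rw [add_zero]; exact updateCol_eq_self _ _
    simp only [D, this]
    exact (g x).det_coe_ne_zero)
  obtain ⟨v', hv', hv'd, hvv⟩ := Real.Angle.exists_contDiff_approx v hv hε
  have hdet : ∀ s ∈ Set.Icc (0 : ℝ) 1, ∀ x,
      ((g x : Matrix ι ι ℂ).updateCol i (v x + s • (v' x - v x))).det ≠ 0 := by
    intro s hs x
    suffices h : s • (v' x - v x) ∈ Metric.ball 0 ε from hεO h x
    rw [mem_ball_zero_iff, norm_smul, Real.norm_of_nonneg hs.1]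
    have := hvv x
    rw [dist_comm, dist_eq_norm] at this
    exact (mul_le_of_le_one_left (norm_nonneg _) hs.2).trans_lt this
  have hd1 : ∀ x, ((g x : Matrix ι ι ℂ).updateCol i (v' x)).det ≠ 0 := fun x ↦ by
    simpa using hdet 1 (by simp) x
  refine ⟨mkGL (fun x ↦ (g x : Matrix ι ι ℂ).updateCol i (v' x)) (hg.matrix_updateCol i hv') hd1,
    ?_, ?_⟩
  · refine homotopic_GL_of_path
      (fun s x ↦ (g x : Matrix ι ι ℂ).updateCol i (v x + s • (v' x - v x))) ?_ hdet ?_ ?_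
    · refine (hg.comp continuous_snd).matrix_updateCol i ?_
      exact (hv.comp continuous_snd).add
        (continuous_fst.smul ((hv'.comp continuous_snd).sub (hv.comp continuous_snd)))
    · intro x
      rw [zero_smul, add_zero]
      exact updateCol_eq_self _ _
    · intro x
      simp
  · convert hv'd using 2 with t
    ext j
    simp [Matrix.col_apply]

/-- A column of a loop of invertible matrices of size at least `2` can be made constant by a
homotopy. -/
theorem exists_homotopic_const_col (hι : 1 < Fintype.card ι) (g : C(Real.Angle, GL ι ℂ)) (i : ι) :
    ∃ g' : C(Real.Angle, GL ι ℂ), g.Homotopic g' ∧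
      ∀ x, (g' x : Matrix ι ι ℂ).col i = Pi.single i 1 := by
  obtain ⟨g₁, hg₁, hsm⟩ := exists_homotopic_contDiff_col g i
  have hc := g₁.continuous_coe_GL
  let v : Real.Angle → ι → ℂ := fun x ↦ (g₁ x : Matrix ι ι ℂ).col i
  have hv : Continuous v := continuous_pi fun j ↦ hc.matrix_elem j i
  have hmv : ∀ x, v x = (g₁ x : Matrix ι ι ℂ) *ᵥ Pi.single i 1 := fun x ↦ by
    rw [mulVec_single_one]
  have hv0 : ∀ x, v x ≠ 0 := fun x h ↦ by
    have h1 : ((g₁ x)⁻¹ : GL ι ℂ).1 *ᵥ v x = Pi.single i 1 := by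
      rw [hmv, mulVec_mulVec, ← Units.val_mul, inv_mul_cancel, Units.val_one, one_mulVec]
    rw [h, mulVec_zero] at h1
    simpa using congrFun h1 i
  obtain ⟨w, hw⟩ := Real.Angle.exists_forall_ne_smul hι v hsm
  obtain ⟨α, hα, hαv, hαw⟩ := Matrix.exists_functional v hv hv0 w hw
  -- As α agrees on `v x` and w, it kills w - `v x`. These are therefore transvections, deforming 1
  -- into a map that sends `v x` to w.
  let T : ℝ → Real.Angle → Matrix ι ι ℂ := fun s x ↦ 1 + vecMulVec (s • (w - v x)) (α x)
  have hT : Continuous (Function.uncurry T) := by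
    refine continuous_const.add (Continuous.matrix_vecMulVec ?_ (hα.comp continuous_snd))
    exact continuous_fst.smul (continuous_const.sub (hv.comp continuous_snd))
  have hTd : ∀ s x, (T s x).det ≠ 0 := fun s x ↦ by
    refine det_one_add_vecMulVec_ne_zero _ _ ?_
    rw [dotProduct_smul, dotProduct_sub, hαv, hαw, sub_self, smul_zero]
  have hT1 : Continuous (T 1) :=
    hT.comp (by fun_prop : Continuous fun x : Real.Angle ↦ ((1 : ℝ), x))
  have hTv : ∀ x, T 1 x *ᵥ v x = w := fun x ↦ by
    simp [T, add_mulVec, vecMulVec_mulVec, hαv]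
  let g₂ : C(Real.Angle, GL ι ℂ) := mkGL (T 1) hT1 (hTd 1) * g₁
  have hg₂ : ∀ x, (g₂ x : Matrix ι ι ℂ) *ᵥ Pi.single i 1 = w := fun x ↦ by
    change (T 1 x * (g₁ x : Matrix ι ι ℂ)) *ᵥ Pi.single i 1 = w
    rw [← mulVec_mulVec, ← hmv, hTv]
  -- The column of `g₂` is now the constant w, so one constant matrix moves it to the basis vector
  -- for all x, without changing the homotopy class.
  refine ⟨const _ (g₂ 0)⁻¹ * g₂, ?_, fun x ↦ ?_⟩
  · refine hg₁.trans (Homotopic.trans ?_ (homotopic_const_mul _ _).symm)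
    have : (1 : C(Real.Angle, GL ι ℂ)).Homotopic (mkGL (T 1) hT1 (hTd 1)) :=
      homotopic_GL_of_path T hT (fun s _ x ↦ hTd s x) (fun x ↦ by simp [T]) (fun x ↦ rfl)
    simpa using this.mul_congr (Homotopic.refl g₁)
  · rw [← mulVec_single_one]
    change (((g₂ 0)⁻¹ : GL ι ℂ).1 * (g₂ x : Matrix ι ι ℂ)) *ᵥ Pi.single i 1 = _
    rw [← mulVec_mulVec, hg₂, ← hg₂ 0, mulVec_mulVec, ← Units.val_mul, inv_mul_cancel,
      Units.val_one, one_mulVec]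

end ContinuousMap

end HomotopyGL

/-! ### Loops in GL_n(ℂ) as powers of a diagonal loop -/

section LoopClassification

variable {ι κ : Type*} [Fintype ι] [DecidableEq ι] [Fintype κ] [DecidableEq κ]

/-- Postcomposition with the homomorphism of general linear groups induced by a continuous
homomorphism of matrix monoids. -/
def ContinuousMap.mapGL {X : Type*} [TopologicalSpace X] (φ : Matrix ι ι ℂ →* Matrix κ κ ℂ)
    (hφ : Continuous φ) : C(X, GL ι ℂ) →* C(X, GL κ ℂ) where
  toFun g := (⟨Units.map φ, hφ.units_map φ⟩ : C(GL ι ℂ, GL κ ℂ)).comp g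
  map_one' := by ext x : 1; exact map_one (Units.map φ)
  map_mul' g h := by ext x : 1; exact map_mul (Units.map φ) (g x) (h x)

theorem ContinuousMap.Homotopic.mapGL {X : Type*} [TopologicalSpace X]
    (φ : Matrix ι ι ℂ →* Matrix κ κ ℂ) (hφ : Continuous φ) {g g' : C(X, GL ι ℂ)}
    (h : g.Homotopic g') :
    (ContinuousMap.mapGL φ hφ g).Homotopic (ContinuousMap.mapGL φ hφ g') :=
  ContinuousMap.Homotopic.comp (.refl (⟨Units.map φ, hφ.units_map φ⟩ : C(GL ι ℂ, GL κ ℂ))) h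

/-- The loop of diagonal matrices with entry `e ^ {i x}` at `i` and `1` elsewhere. -/
def Matrix.diagLoop (i : ι) : C(Real.Angle, GL ι ℂ) :=
  ContinuousMap.mkGL (fun x ↦ diagonal (Function.update 1 i (x.toCircle : ℂ)))
    (Continuous.matrix_diagonal
      (continuous_const.update i Real.Angle.continuous_coe_toCircle))
    (fun x ↦ by
      rw [det_diagonal, Finset.prod_ne_zero_iff]
      intro j _
      by_cases h : j = i <;> simp [h])

/-- The inclusion of matrices as an upper left block. -/
def Matrix.blockHom (ι κ : Type*) [Fintype ι] [DecidableEq ι] [Fintype κ] [DecidableEq κ] :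
    Matrix ι ι ℂ →* Matrix (ι ⊕ κ) (ι ⊕ κ) ℂ where
  toFun A := fromBlocks A 0 0 1
  map_one' := fromBlocks_one
  map_mul' A B := by simp [fromBlocks_multiply]

theorem Matrix.continuous_blockHom : Continuous (Matrix.blockHom ι κ) :=
  continuous_id.matrix_fromBlocks continuous_const continuous_const continuous_const

/-- Reindexing as a homomorphism of matrix monoids. -/
def Matrix.reindexHom (e : ι ≃ κ) : Matrix ι ι ℂ →* Matrix κ κ ℂ :=
  (reindexAlgEquiv ℂ ℂ e : Matrix ι ι ℂ →* Matrix κ κ ℂ)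

theorem Matrix.continuous_reindexHom (e : ι ≃ κ) : Continuous (Matrix.reindexHom e) :=
  continuous_id.matrix_submatrix e.symm e.symm

theorem Matrix.mapGL_blockHom_diagLoop (j : ι) :
    ContinuousMap.mapGL (blockHom ι κ) continuous_blockHom (diagLoop j) =
      diagLoop (Sum.inl j : ι ⊕ κ) := by
  ext x : 2
  change fromBlocks (diagonal _) 0 0 1 = diagonal _
  rw [← diagonal_one, fromBlocks_diagonal]
  congr 1
  ext a
  rcases a with a | a
  · by_cases h : a = j <;> simp [h]
  · simp

theorem Matrix.mapGL_reindexHom_diagLoop (e : ι ≃ κ) (j : ι) :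
    ContinuousMap.mapGL (reindexHom e) (continuous_reindexHom e) (diagLoop j) =
      diagLoop (e j) := by
  ext x : 2
  change (diagonal _).submatrix _ _ = diagonal _
  rw [submatrix_diagonal_equiv]
  congr 1
  ext a
  by_cases h : a = e j
  · simp [h]
  · have : e.symm a ≠ j := fun h' ↦ h (by simp [← h'])
    simp [h, this]

/-- A continuous nowhere zero function on the circle is `e ^ {i d x}` times an exponential. -/
theorem Real.Angle.exists_eq_zpow_mul_exp (u : Real.Angle → ℂ) (hu : Continuous u)
    (hu0 : ∀ x, u x ≠ 0) : ∃ (d : ℤ) (l : Real.Angle → ℂ), Continuous l ∧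
      ∀ x : Real.Angle, u x = (x.toCircle : ℂ) ^ d * Complex.exp (l x) := by
  obtain ⟨L, ⟨-, hL⟩, -⟩ := Complex.isCoveringMapOn_exp.existsUnique_continuousMap_lifts
    (⟨fun t : ℝ ↦ u t, hu.comp Real.Angle.continuous_coe⟩ : C(ℝ, ℂ))
    (a₀ := 0) (Complex.exp_log (hu0 (0 : ℝ))) (fun t ↦ hu0 t)
  have hL' : ∀ t : ℝ, Complex.exp (L t) = u t := fun t ↦ congrFun hL t
  -- The winding number d: subtracting i d t from the logarithm L makes it periodic.
  obtain ⟨d, hd⟩ : ∃ d : ℤ, L (2 * Real.pi) = L 0 + d * (2 * Real.pi * Complex.I) := by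
    rw [← Complex.exp_eq_exp_iff_exists_int, hL', hL']
    simp
  obtain ⟨l, hl, hl'⟩ := Real.Angle.exists_continuous_of_eq_endpoints
    (fun t ↦ L t - d * (t * Complex.I)) (by fun_prop) (by rw [hd]; push_cast; ring)
  refine ⟨d, l, hl, fun x ↦ ?_⟩
  obtain ⟨t, ht, rfl⟩ := Real.Angle.exists_coe_eq x
  rw [hl' t ht, Real.Angle.toCircle_coe, Circle.coe_exp, ← Complex.exp_int_mul, ← Complex.exp_add,
    ← hL']
  congr 1
  ring

namespace ContinuousMap

/-- A 1 × 1 loop is z^d exp(l) with l a function on the circle, and scaling l to 0 contracts the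
exponential factor. -/
theorem homotopic_diagLoop_zpow_of_unique [Unique ι] (g : C(Real.Angle, GL ι ℂ)) (i : ι) :
    ∃ d : ℤ, g.Homotopic (diagLoop i ^ d) := by
  have hg := g.continuous_coe_GL
  have hdiag : ∀ M : Matrix ι ι ℂ, M = diagonal fun _ ↦ M i i := fun M ↦ by
    ext a b
    rw [Subsingleton.elim a i, Subsingleton.elim b i]
    simp
  have hu0 : ∀ x, (g x : Matrix ι ι ℂ) i i ≠ 0 := fun x h ↦ by
    have := (g x).det_coe_ne_zero
    rw [hdiag (g x : Matrix ι ι ℂ), h] at this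
    simp at this
  obtain ⟨d, l, hl, h⟩ := Real.Angle.exists_eq_zpow_mul_exp _ (hg.matrix_elem i i) hu0
  let E : ℝ → Real.Angle → Matrix ι ι ℂ := fun s x ↦ diagonal fun _ ↦ Complex.exp (s * l x)
  have hEc : Continuous (Function.uncurry E) := by
    refine Continuous.matrix_diagonal (continuous_pi fun _ ↦ Continuous.cexp ?_)
    exact (Complex.continuous_ofReal.comp continuous_fst).mul (hl.comp continuous_snd)
  have hEd : ∀ s x, (E s x).det ≠ 0 := fun s x ↦ by
    rw [det_diagonal, Finset.prod_ne_zero_iff]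
    exact fun _ _ ↦ Complex.exp_ne_zero _
  let e : C(Real.Angle, GL ι ℂ) := mkGL (E 1)
    (hEc.comp (by fun_prop : Continuous fun x : Real.Angle ↦ ((1 : ℝ), x))) (hEd 1)
  have he : e.Homotopic 1 := Homotopic.symm <|
    homotopic_GL_of_path E hEc (fun s _ x ↦ hEd s x) (fun x ↦ by simp [E]) (fun x ↦ rfl)
  have hpow : ∀ x, ((diagLoop i x ^ d : GL ι ℂ) : Matrix ι ι ℂ) i i = (x.toCircle : ℂ) ^ d := by
    intro x
    let φ : Matrix ι ι ℂ →* ℂ := Matrix.detMonoidHom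
    have h1 : ∀ M : Matrix ι ι ℂ, φ M = M i i := fun M ↦ by
      rw [Subsingleton.elim i default]; exact det_unique M
    have h2 := map_zpow (Units.map φ) (diagLoop i x) d
    have h3 := congrArg Units.val h2
    rw [Units.coe_map, Units.val_zpow_eq_zpow_val, Units.coe_map] at h3
    rw [h1, h1] at h3
    rw [h3]
    simp [diagLoop]
  refine ⟨d, ?_⟩
  have hge : g = diagLoop i ^ d * e := by
    ext x : 2
    change (g x : Matrix ι ι ℂ) = ((diagLoop i x ^ d : GL ι ℂ) : Matrix ι ι ℂ) * E 1 x
    rw [hdiag (g x : Matrix ι ι ℂ), hdiag ((diagLoop i x ^ d : GL ι ℂ) : Matrix ι ι ℂ), hpow,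
      diagonal_mul_diagonal, h]
    simp
  rw [hge]
  simpa using (Homotopic.refl (diagLoop i ^ d)).mul_congr he

/-- Every loop of invertible complex matrices is homotopic to a power of the standard loop. -/
theorem homotopic_diagLoop_zpow (m : ℕ) : ∀ {ι : Type _} [Fintype ι] [DecidableEq ι],
    Fintype.card ι = m + 1 → ∀ (g : C(Real.Angle, GL ι ℂ)) (i : ι),
      ∃ d : ℤ, g.Homotopic (diagLoop i ^ d) := by
  induction m with
  | zero =>
    intro ι _ _ hι g i
    have : Unique ι := (Fintype.card_eq_one_iff_nonempty_unique.1 hι).some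
    exact homotopic_diagLoop_zpow_of_unique g i
  | succ m ih =>
    intro ι _ _ hι g i
    have : Nontrivial ι := Fintype.one_lt_card_iff_nontrivial.1 (by omega)
    -- The index split off differs from i, so that the standard loop at i survives in the smaller
    -- block.
    obtain ⟨l, hl⟩ := exists_ne i
    let e : {a // a ≠ l} ⊕ PUnit.{1} ≃ ι :=
      (Equiv.optionEquivSumPUnit.{0} _).symm.trans (Equiv.optionSubtypeNe l)
    obtain ⟨g', hg', hcol⟩ := exists_homotopic_const_col
      (ι := {a // a ≠ l} ⊕ PUnit.{1}) (by rw [Fintype.card_congr e]; omega)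
      (mapGL (reindexHom e.symm) (continuous_reindexHom e.symm) g) (Sum.inr PUnit.unit)
    have hc := g'.continuous_coe_GL
    let A : Real.Angle → Matrix {a // a ≠ l} {a // a ≠ l} ℂ := fun x ↦ (g' x).1.toBlocks₁₁
    let B : Real.Angle → Matrix PUnit.{1} {a // a ≠ l} ℂ := fun x ↦ (g' x).1.toBlocks₂₁
    have hA : Continuous A := continuous_matrix fun a b ↦ hc.matrix_elem _ _
    have hB : Continuous B := continuous_matrix fun a b ↦ hc.matrix_elem _ _
    have hAB : ∀ x, (g' x).1 = fromBlocks (A x) 0 (B x) 1 := fun x ↦ by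
      rw [← fromBlocks_toBlocks (g' x).1]
      congr 1
      · ext a b
        exact (congrFun (hcol x) (Sum.inl a)).trans (by simp)
      · ext a b
        exact (congrFun (hcol x) (Sum.inr a)).trans (by simp)
    have hAd : ∀ x, (A x).det ≠ 0 := fun x ↦ by
      have := (g' x).det_coe_ne_zero
      rw [hAB, det_fromBlocks_zero₁₂, det_one, mul_one] at this
      exact this
    -- The matrix is block lower triangular, so scaling the off-diagonal block B to zero leaves the
    -- determinant unchanged.
    have h1 : g'.Homotopic (mapGL (blockHom _ PUnit.{1}) continuous_blockHom (mkGL A hA hAd)) := by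
      refine Homotopic.symm (homotopic_GL_of_path
        (fun s x ↦ fromBlocks (A x) 0 (s • B x) 1) ?_ ?_ ?_ ?_)
      · exact (hA.comp continuous_snd).matrix_fromBlocks continuous_const
          (continuous_fst.smul (hB.comp continuous_snd)) continuous_const
      · intro s _ x
        rw [det_fromBlocks_zero₁₂, det_one, mul_one]
        exact hAd x
      · intro x
        rw [zero_smul]
        rfl
      · intro x
        rw [one_smul, hAB]
    obtain ⟨d, hd⟩ := ih (ι := {a // a ≠ l}) (by
      have := Fintype.card_congr e
      simp only [Fintype.card_sum, Fintype.card_punit] at this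
      omega) (mkGL A hA hAd) ⟨i, hl.symm⟩
    refine ⟨d, ?_⟩
    have h2 := (hg'.trans (h1.trans (hd.mapGL (blockHom _ PUnit.{1}) continuous_blockHom)))
    have h3 := h2.mapGL (reindexHom e) (continuous_reindexHom e)
    rw [map_zpow, map_zpow, mapGL_blockHom_diagLoop, mapGL_reindexHom_diagLoop] at h3
    have h4 : mapGL (reindexHom e) (continuous_reindexHom e)
        (mapGL (reindexHom e.symm) (continuous_reindexHom e.symm) g) = g := by
      ext x a b
      change (g x : Matrix ι ι ℂ) (e (e.symm a)) (e (e.symm b)) = _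
      simp
    have h5 : e (Sum.inl ⟨i, hl.symm⟩) = i := rfl
    rwa [h4, h5] at h3

end ContinuousMap

/-- The square root of `z` acting on the summand `i` of a block matrix, and the identity on the
other summands. -/
def Matrix.singleRoot {n : Type*} [DecidableEq n] (i : n) (z : ℂ) : Matrix (n ⊕ n) (n ⊕ n) ℂ :=
  fromBlocks (1 - Matrix.single i i 1) (z • Matrix.single i i 1) (Matrix.single i i 1)
    (1 - Matrix.single i i 1)

/-- On the i-th coordinate 2-plane `singleRoot` coincides with `blockRoot`, and on the other planes
it is the identity. -/
theorem Matrix.commute_singleRoot_blockRoot {n : Type*} [Fintype n] [DecidableEq n] (i : n)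
    (z : ℂ) : Commute (singleRoot i z) (blockRoot n z) := by
  simp [Commute, SemiconjBy, singleRoot, blockRoot, fromBlocks_multiply]

/-- For z running over the unit circle this exhibits a constant matrix times `diagLoop (Sum.inr i)`,
which fixes the homotopy class of the commuting loop. -/
theorem Matrix.singleRoot_eq_mul {n : Type*} [Fintype n] [DecidableEq n] (i : n) (z : ℂ) :
    singleRoot i z = singleRoot i 1 * diagonal (Function.update 1 (Sum.inr i) z) := by
  ext a b
  rw [mul_diagonal]
  rcases a with a | a <;> rcases b with b | b
  · simp [singleRoot]
  · by_cases h : b = i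
    · by_cases h' : a = i <;> simp [singleRoot, h, h', Matrix.single_apply]
    · have : i ≠ b := Ne.symm h
      simp [singleRoot, h, this]
  · simp [singleRoot]
  · by_cases h : b = i
    · subst h
      by_cases h' : a = b
      · simp [singleRoot, h']
      · have : b ≠ a := Ne.symm h'
        simp [singleRoot, h', this]
    · simp [singleRoot, h]

theorem Matrix.singleRoot_one_mul_self {n : Type*} [Fintype n] [DecidableEq n] (i : n) :
    singleRoot i 1 * singleRoot i 1 = 1 := by
  simp only [singleRoot, one_smul, fromBlocks_multiply, ← fromBlocks_one]
  congr 1 <;> simp [mul_sub, sub_mul]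

/-- Every loop of invertible matrices of size `n ⊕ n` is homotopic to one that commutes with the
standard square root of the coordinate function. -/
theorem ContinuousMap.exists_homotopic_commute_blockRoot (m : ℕ)
    (g : C(Real.Angle, GL (Fin m ⊕ Fin m) ℂ)) :
    ∃ c : C(Real.Angle, GL (Fin m ⊕ Fin m) ℂ), c.Homotopic g ∧
      ∀ x : Real.Angle, Commute (c x : Matrix (Fin m ⊕ Fin m) (Fin m ⊕ Fin m) ℂ)
        (blockRoot (Fin m) x.toCircle) := by
  rcases m with _ | m
  · refine ⟨g, Homotopic.refl g, fun x ↦ ?_⟩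
    exact Subsingleton.elim _ _
  · let i : Fin (m + 1) := 0
    obtain ⟨d, hd⟩ := homotopic_diagLoop_zpow (2 * m + 1)
      (by rw [Fintype.card_sum, Fintype.card_fin]; omega) g (Sum.inr i)
    let S : GL (Fin (m + 1) ⊕ Fin (m + 1)) ℂ :=
      ⟨singleRoot i 1, singleRoot i 1, singleRoot_one_mul_self i, singleRoot_one_mul_self i⟩
    let C : C(Real.Angle, GL (Fin (m + 1) ⊕ Fin (m + 1)) ℂ) := const _ S * diagLoop (Sum.inr i)
    have hC : ∀ x : Real.Angle, (C x : Matrix _ _ ℂ) = singleRoot i x.toCircle := fun x ↦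
      (singleRoot_eq_mul i x.toCircle).symm
    refine ⟨C ^ d, ((homotopic_const_mul _ _).zpow_congr d).trans hd.symm, fun x ↦ ?_⟩
    have h1 : Commute (C x : Matrix _ _ ℂ) (blockRoot (Fin (m + 1)) x.toCircle) := by
      rw [hC]
      exact commute_singleRoot_blockRoot i _
    exact h1.units_zpow_left d

end LoopClassification

/-! ### Frames on the torus -/

namespace Real.Angle

/-- The representative in `[0, π]` of an angle up to sign. -/
def absReal (y : Real.Angle) : ℝ := Real.arccos y.cos

theorem continuous_absReal : Continuous absReal :=
  Real.continuous_arccos.comp Real.Angle.continuous_cos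

theorem absReal_mem_Icc (y : Real.Angle) : y.absReal ∈ Set.Icc 0 Real.pi :=
  ⟨Real.arccos_nonneg _, Real.arccos_le_pi _⟩

theorem absReal_neg (y : Real.Angle) : (-y).absReal = y.absReal := by
  rw [absReal, absReal, Real.Angle.cos_neg]

theorem coe_absReal_of_sin_nonneg {y : Real.Angle} (hy : 0 ≤ y.sin) :
    (y.absReal : Real.Angle) = y := by
  induction y using Real.Angle.induction_on with
  | _ t =>
  rw [Real.Angle.sin_coe] at hy
  rw [absReal, Real.Angle.cos_coe]
  refine Real.Angle.cos_sin_inj ?_ ?_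
  · exact Real.cos_arccos (Real.neg_one_le_cos t) (Real.cos_le_one t)
  · rw [Real.sin_arccos, ← Real.abs_sin_eq_sqrt_one_sub_cos_sq, abs_of_nonneg hy]

theorem coe_absReal_of_sin_nonpos {y : Real.Angle} (hy : y.sin ≤ 0) :
    (y.absReal : Real.Angle) = -y := by
  rw [← absReal_neg, coe_absReal_of_sin_nonneg (by rw [Real.Angle.sin_neg]; linarith)]

theorem absReal_eq_of_sin_eq_zero {y : Real.Angle} (hy : y.sin = 0) :
    y.absReal = 0 ∨ y.absReal = Real.pi := by
  rcases Real.Angle.sin_eq_zero_iff.1 hy with rfl | rfl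
  · left; simp [absReal]
  · right; simp [absReal]

end Real.Angle

/-! ### Gluing equivariant frames along the fixed circles -/

section TorusFrame

variable {κ : Type*} [Fintype κ] [DecidableEq κ]

/-- A frame over half of the torus that is compatible with the involution on the boundary extends
to an equivariant frame on the torus. -/
theorem Matrix.exists_frame_of_half_frame {κ : Type*} [Fintype κ] {m : ℕ}
    (P Λ : Real.Angle × Real.Angle → Matrix κ κ ℂ) (hΛ : Continuous Λ)
    (hΛP : ∀ p, Λ p * P p = Λ p)
    (hΛΛ : ∀ x y, Λ (x, -y) * Λ (x, y) = (x.toCircle : ℂ) • P (x, y))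
    (S₀ : Real.Angle × ℝ → Matrix κ (Fin m ⊕ Fin m) ℂ)
    (T₀ : Real.Angle × ℝ → Matrix (Fin m ⊕ Fin m) κ ℂ) (hS₀ : Continuous S₀) (hT₀ : Continuous T₀)
    (hTS : ∀ x, ∀ t ∈ Set.Icc 0 Real.pi, T₀ (x, t) * S₀ (x, t) = 1)
    (hST : ∀ x, ∀ t ∈ Set.Icc 0 Real.pi, S₀ (x, t) * T₀ (x, t) = P (x, t))
    (hb : ∀ x (t : ℝ), t = 0 ∨ t = Real.pi →
      Λ (x, t) * S₀ (x, t) = S₀ (x, t) * blockRoot (Fin m) x.toCircle) :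
    ∃ (S : Real.Angle × Real.Angle → Matrix κ (Fin m ⊕ Fin m) ℂ)
      (T : Real.Angle × Real.Angle → Matrix (Fin m ⊕ Fin m) κ ℂ), Continuous S ∧ Continuous T ∧
      (∀ p, T p * S p = 1) ∧ (∀ p, S p * T p = P p) ∧
      ∀ x y, Λ (x, y) * S (x, y) = S (x, -y) * blockRoot (Fin m) x.toCircle := by
  let z : Real.Angle → ℂ := fun x ↦ x.toCircle
  have hz : ∀ x, z x ≠ 0 := fun x ↦ Circle.coe_ne_zero _
  have hzc : Continuous z := Real.Angle.continuous_coe_toCircle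
  let R : Real.Angle → Matrix (Fin m ⊕ Fin m) (Fin m ⊕ Fin m) ℂ := fun x ↦ blockRoot (Fin m) (z x)
  let R' : Real.Angle → Matrix (Fin m ⊕ Fin m) (Fin m ⊕ Fin m) ℂ := fun x ↦ (z x)⁻¹ • R x
  have hRR' : ∀ x, R x * R' x = 1 := fun x ↦ by
    simp only [R, R', Matrix.mul_smul, blockRoot_mul_self, smul_smul, inv_mul_cancel₀ (hz x),
      one_smul]
  have hR'R : ∀ x, R' x * R x = 1 := fun x ↦ by
    simp only [R, R', Matrix.smul_mul, blockRoot_mul_self, smul_smul, inv_mul_cancel₀ (hz x),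
      one_smul]
  have hRc : Continuous R :=
    continuous_const.matrix_fromBlocks (hzc.smul continuous_const) continuous_const continuous_const
  have hR'c : Continuous R' := (hzc.inv₀ hz).smul hRc
  have hPS : ∀ x, ∀ t ∈ Set.Icc 0 Real.pi, P (x, t) * S₀ (x, t) = S₀ (x, t) := fun x t ht ↦ by
    rw [← hST x t ht, Matrix.mul_assoc, hTS x t ht, Matrix.mul_one]
  have hbT : ∀ x (t : ℝ), t = 0 ∨ t = Real.pi → T₀ (x, t) * Λ (x, t) = R x * T₀ (x, t) := by
    intro x t ht
    have ht' : t ∈ Set.Icc 0 Real.pi := by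
      rcases ht with rfl | rfl <;> simp [Real.pi_pos.le]
    calc T₀ (x, t) * Λ (x, t) = T₀ (x, t) * (Λ (x, t) * S₀ (x, t)) * T₀ (x, t) := by
          rw [Matrix.mul_assoc, Matrix.mul_assoc, hST x t ht', hΛP]
      _ = R x * T₀ (x, t) := by
          rw [hb x t ht, ← Matrix.mul_assoc, hTS x t ht', Matrix.one_mul]
  have hΛΛ' : ∀ x y, Λ (x, y) * Λ (x, -y) = (z x) • P (x, -y) := fun x y ↦ by
    simpa using hΛΛ x (-y)
  -- On the lower half equivariance forces the formula: apply Λ to the frame at the reflected point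
  -- and undo `blockRoot`. The boundary condition `hb` makes both formulas agree where sin y = 0.
  let S : Real.Angle × Real.Angle → Matrix κ (Fin m ⊕ Fin m) ℂ := fun p ↦
    if 0 ≤ p.2.sin then S₀ (p.1, p.2.absReal)
    else Λ (p.1, -p.2) * S₀ (p.1, p.2.absReal) * R' p.1
  -- On the ranges of P, z⁻¹ Λ(x, y) is the inverse of Λ(x, -y), so this is the coframe dual to S.
  let T : Real.Angle × Real.Angle → Matrix (Fin m ⊕ Fin m) κ ℂ := fun p ↦
    if 0 ≤ p.2.sin then T₀ (p.1, p.2.absReal)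
    else R p.1 * T₀ (p.1, p.2.absReal) * ((z p.1)⁻¹ • Λ p)
  have hac : Continuous fun p : Real.Angle × Real.Angle ↦ (p.1, p.2.absReal) :=
    continuous_fst.prodMk (Real.Angle.continuous_absReal.comp continuous_snd)
  have hsc : Continuous fun p : Real.Angle × Real.Angle ↦ p.2.sin :=
    Real.Angle.continuous_sin.comp continuous_snd
  have hS : Continuous S := by
    refine Continuous.if_le (hS₀.comp hac) ?_ continuous_const hsc ?_
    · have h1 : Continuous fun p : Real.Angle × Real.Angle ↦ Λ (p.1, -p.2) :=
        hΛ.comp (by fun_prop)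
      exact (h1.matrix_mul (hS₀.comp hac)).matrix_mul (hR'c.comp continuous_fst)
    · rintro ⟨x, y⟩ hy
      simp only at hy ⊢
      rw [← Real.Angle.coe_absReal_of_sin_nonpos hy.ge,
        hb x _ (Real.Angle.absReal_eq_of_sin_eq_zero hy.symm), Matrix.mul_assoc]
      exact ((congrArg _ (hRR' x)).trans (Matrix.mul_one _)).symm
  have hT : Continuous T := by
    refine Continuous.if_le (hT₀.comp hac) ?_ continuous_const hsc ?_
    · exact ((hRc.comp continuous_fst).matrix_mul (hT₀.comp hac)).matrix_mul
        (((hzc.comp continuous_fst).inv₀ fun p ↦ hz _).smul hΛ)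
    · rintro ⟨x, y⟩ hy
      simp only at hy ⊢
      have h := hbT x _ (Real.Angle.absReal_eq_of_sin_eq_zero hy.symm)
      rw [Real.Angle.coe_absReal_of_sin_nonneg hy.le] at h
      rw [Matrix.mul_smul, Matrix.mul_assoc, h, ← Matrix.mul_assoc, ← Matrix.smul_mul,
        ← Matrix.mul_smul]
      exact ((congrArg (· * _) (hRR' x)).trans (Matrix.one_mul _)).symm
  refine ⟨S, T, hS, hT, ?_, ?_, ?_⟩
  · rintro ⟨x, y⟩
    by_cases hy : 0 ≤ y.sin
    · simp only [S, T, hy, if_true]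
      exact hTS x _ y.absReal_mem_Icc
    · have hy' : y.sin ≤ 0 := (not_le.1 hy).le
      simp only [S, T, hy, if_false]
      rw [← Real.Angle.coe_absReal_of_sin_nonpos hy']
      have hyy : y = -(y.absReal : Real.Angle) := by
        rw [Real.Angle.coe_absReal_of_sin_nonpos hy', neg_neg]
      have h1 : (z x)⁻¹ • Λ (x, y) * Λ (x, y.absReal) = P (x, y.absReal) := by
        conv_lhs => enter [1, 2, 1, 2]; rw [hyy]
        rw [Matrix.smul_mul, hΛΛ, smul_smul]
        exact (congrArg (· • _) (inv_mul_cancel₀ (hz x))).trans (one_smul _ _)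
      calc _ = R x * (T₀ (x, y.absReal) * (((z x)⁻¹ • Λ (x, y) * Λ (x, y.absReal)) *
            S₀ (x, y.absReal))) * R' x := by simp only [Matrix.mul_assoc]
        _ = 1 := by
          rw [h1, hPS x _ y.absReal_mem_Icc, hTS x _ y.absReal_mem_Icc, Matrix.mul_one, hRR']
  · rintro ⟨x, y⟩
    by_cases hy : 0 ≤ y.sin
    · simp only [S, T, hy, if_true]
      rw [hST x _ y.absReal_mem_Icc, Real.Angle.coe_absReal_of_sin_nonneg hy]
    · have hy' : y.sin ≤ 0 := (not_le.1 hy).le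
      simp only [S, T, hy, if_false]
      have h1 : R' x * R x = 1 := hR'R x
      calc _ = Λ (x, -y) * (S₀ (x, y.absReal) * (R' x * R x) * T₀ (x, y.absReal)) *
            ((z x)⁻¹ • Λ (x, y)) := by simp only [Matrix.mul_assoc]
        _ = P (x, y) := by
          rw [h1, Matrix.mul_one, hST x _ y.absReal_mem_Icc,
            Real.Angle.coe_absReal_of_sin_nonpos hy', hΛP, Matrix.mul_smul, hΛΛ, smul_smul]
          exact (congrArg (· • _) (inv_mul_cancel₀ (hz x))).trans (one_smul _ _)
  · intro x y
    change Λ (x, y) * S (x, y) = S (x, -y) * R x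
    rcases lt_trichotomy y.sin 0 with hy | hy | hy
    · have h1 : ¬ 0 ≤ y.sin := not_le.2 hy
      have h2 : 0 ≤ (-y).sin := by rw [Real.Angle.sin_neg]; linarith
      simp only [S, h1, h2, if_true, if_false, Real.Angle.absReal_neg]
      rw [← Matrix.mul_assoc, ← Matrix.mul_assoc, hΛΛ', Matrix.smul_mul,
        ← Real.Angle.coe_absReal_of_sin_nonpos hy.le, hPS x _ y.absReal_mem_Icc, Matrix.smul_mul,
        ← Matrix.mul_smul]
      congr 1
      simp only [R', smul_smul, mul_inv_cancel₀ (hz x), one_smul]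
    · have h1 : 0 ≤ y.sin := hy.ge
      have h2 : 0 ≤ (-y).sin := by rw [Real.Angle.sin_neg]; linarith
      simp only [S, h1, h2, if_true, Real.Angle.absReal_neg]
      have := hb x _ (Real.Angle.absReal_eq_of_sin_eq_zero hy)
      rwa [Real.Angle.coe_absReal_of_sin_nonneg h1] at this
    · have h1 : 0 ≤ y.sin := hy.le
      have h2 : ¬ 0 ≤ (-y).sin := by rw [Real.Angle.sin_neg]; linarith
      simp only [S, h1, h2, if_true, if_false, Real.Angle.absReal_neg, neg_neg]
      rw [Matrix.mul_assoc, Matrix.mul_assoc, hR'R, Matrix.mul_one]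

/-- A bundle on the torus with a square root of `e ^ {i k_x}` that covers the reflection
`k_y ↦ -k_y` has an equivariant frame. -/
theorem Matrix.exists_equivariant_frame
    (P Λ : Real.Angle × Real.Angle → Matrix κ κ ℂ) (hP : Continuous P) (hΛ : Continuous Λ)
    (hPP : ∀ p, P p * P p = P p) (hΛP : ∀ p, Λ p * P p = Λ p)
    (hΛΛ : ∀ x y, Λ (x, -y) * Λ (x, y) = (x.toCircle : ℂ) • P (x, y)) :
    ∃ (m : ℕ) (S : Real.Angle × Real.Angle → Matrix κ (Fin m ⊕ Fin m) ℂ)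
      (T : Real.Angle × Real.Angle → Matrix (Fin m ⊕ Fin m) κ ℂ), Continuous S ∧ Continuous T ∧
      (∀ p, T p * S p = 1) ∧ (∀ p, S p * T p = P p) ∧
      ∀ x y, Λ (x, y) * S (x, y) = S (x, -y) * blockRoot (Fin m) x.toCircle := by
  have hslice : ∀ y : Real.Angle, Continuous fun x : Real.Angle ↦ (x, y) := fun y ↦ by fun_prop
  obtain ⟨m, F₀, G₀, hF₀, hG₀, hGF₀, hFG₀, hJ₀⟩ := exists_frame_of_root
    (fun x ↦ P (x, 0)) (fun x ↦ Λ (x, 0)) (hP.comp (hslice _)) (hΛ.comp (hslice _))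
    (fun x ↦ hPP _) (fun x ↦ hΛP _) (fun x ↦ by simpa using hΛΛ x 0)
  obtain ⟨m', F₁, G₁, hF₁, hG₁, hGF₁, hFG₁, hJ₁⟩ := exists_frame_of_root
    (fun x ↦ P (x, Real.pi)) (fun x ↦ Λ (x, Real.pi)) (hP.comp (hslice _)) (hΛ.comp (hslice _))
    (fun x ↦ hPP _) (fun x ↦ hΛP _) (fun x ↦ by simpa using hΛΛ x Real.pi)
  obtain ⟨U, hU, hUd, hU0, hUi⟩ := Matrix.exists_transport
    (fun (t : ℝ) (x : Real.Angle) ↦ P (x, t))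
    (hP.comp (continuous_snd.prodMk (Real.Angle.continuous_coe.comp continuous_fst)))
    (fun t _ ↦ hPP _) Real.pi Real.pi_pos.le
  simp only [Real.Angle.coe_zero] at hUi
  have uU : ∀ t x, IsUnit (U t x).det := fun t x ↦ (hUd t x).isUnit
  have hUP : ∀ t ∈ Set.Icc 0 Real.pi, ∀ x, U t x * P (x, 0) * (U t x)⁻¹ = P (x, t) := by
    intro t ht x
    rw [hUi t ht x, mul_assoc, mul_nonsing_inv _ (uU _ _), mul_one]
  have hπ : Real.pi ∈ Set.Icc 0 Real.pi := ⟨Real.pi_pos.le, le_rfl⟩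
  -- The trace of an idempotent is its rank, and transport conjugates P at y = 0 to P at y = π.
  obtain rfl : m = m' := by
    have h1 : (P (0, 0)).trace = (m + m : ℕ) := by
      rw [← hFG₀, trace_mul_comm, hGF₀, trace_one]; simp
    have h2 : (P (0, Real.pi)).trace = (m' + m' : ℕ) := by
      rw [← hFG₁, trace_mul_comm, hGF₁, trace_one]; simp
    rw [← hUP _ hπ, trace_mul_comm, ← mul_assoc, nonsing_inv_mul _ (uU _ _), one_mul, h1] at h2
    have := Nat.cast_injective h2
    omega
  -- The mismatch between the frame transported from y = 0 and the standard frame at y = π.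
  let g₀ : Real.Angle → Matrix (Fin m ⊕ Fin m) (Fin m ⊕ Fin m) ℂ := fun x ↦
    G₁ x * U Real.pi x * F₀ x
  have hUπ : Continuous fun x ↦ U Real.pi x :=
    hU.comp (by fun_prop : Continuous fun x : Real.Angle ↦ (Real.pi, x))
  have hg₀ : Continuous g₀ := (hG₁.matrix_mul hUπ).matrix_mul hF₀
  have hg₀d : ∀ x, (g₀ x).det ≠ 0 := fun x h ↦ by
    have h1 : g₀ x * (G₀ x * (U Real.pi x)⁻¹ * F₁ x) = 1 := by
      calc _ = G₁ x * (U Real.pi x * (F₀ x * G₀ x) * (U Real.pi x)⁻¹) * F₁ x := by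
            simp only [g₀, Matrix.mul_assoc]
        _ = 1 := by
          rw [hFG₀, hUP _ hπ, ← hFG₁, ← Matrix.mul_assoc, hGF₁, Matrix.one_mul, hGF₁]
    have := congrArg det h1
    rw [det_mul, h] at this
    simp at this
  let g : C(Real.Angle, GL (Fin m ⊕ Fin m) ℂ) := ContinuousMap.mkGL g₀ hg₀ hg₀d
  obtain ⟨c, ⟨H⟩, hc⟩ := ContinuousMap.exists_homotopic_commute_blockRoot m g⁻¹
  -- A change of frame across the cylinder: at y = 0 it commutes with `blockRoot`, so the frame
  -- stays standard; at y = π it cancels the mismatch, so the frame becomes `F₁`.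
  let h : Real.Angle × ℝ → GL (Fin m ⊕ Fin m) ℂ := fun p ↦
    H (Set.projIcc 0 1 zero_le_one (p.2 / Real.pi), p.1)
  have hh : Continuous h := H.continuous.comp
    ((continuous_projIcc.comp (by fun_prop)).prodMk continuous_fst)
  have h0 : ∀ x, h (x, 0) = c x := fun x ↦ by simp [h]
  have h1 : ∀ x, h (x, Real.pi) = (g x)⁻¹ := fun x ↦ by simp [h, Real.pi_ne_zero]
  have hUs : Continuous fun p : Real.Angle × ℝ ↦ U p.2 p.1 := hU.comp continuous_swap
  refine ⟨m, exists_frame_of_half_frame P Λ hΛ hΛP hΛΛ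
    (fun p ↦ U p.2 p.1 * F₀ p.1 * (h p).1) (fun p ↦ (h p)⁻¹.1 * G₀ p.1 * (U p.2 p.1)⁻¹)
    ?_ ?_ ?_ ?_ ?_⟩
  · exact (hUs.matrix_mul (hF₀.comp continuous_fst)).matrix_mul (Units.continuous_val.comp hh)
  · exact ((Units.continuous_val.comp hh.inv).matrix_mul (hG₀.comp continuous_fst)).matrix_mul
      (hUs.matrix_inv_of_det_ne_zero fun p ↦ hUd _ _)
  · intro x t ht
    calc _ = (h (x, t))⁻¹.1 * (G₀ x * ((U t x)⁻¹ * U t x) * F₀ x) * (h (x, t)).1 := by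
          simp only [Matrix.mul_assoc]
      _ = 1 := by
        rw [nonsing_inv_mul _ (uU _ _), Matrix.mul_one, hGF₀, Matrix.mul_one, Units.inv_mul]
  · intro x t ht
    calc _ = U t x * (F₀ x * ((h (x, t)).1 * (h (x, t))⁻¹.1) * G₀ x) * (U t x)⁻¹ := by
          simp only [Matrix.mul_assoc]
      _ = P (x, t) := by
        rw [Units.mul_inv, Matrix.mul_one, hFG₀, hUP t ht]
  · rintro x t (rfl | rfl)
    · simp only [hU0, Matrix.one_mul, h0, Real.Angle.coe_zero]
      rw [← Matrix.mul_assoc, hJ₀, Matrix.mul_assoc, ← (hc x).eq, Matrix.mul_assoc]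
    · have h2 : U Real.pi x * F₀ x * (h (x, Real.pi)).1 = F₁ x := by
        have h3 : F₁ x * g₀ x = U Real.pi x * F₀ x := by
          calc F₁ x * g₀ x = (F₁ x * G₁ x) * U Real.pi x * F₀ x := by
                simp only [g₀, Matrix.mul_assoc]
            _ = U Real.pi x * F₀ x := by
              rw [hFG₁, ← hUi _ hπ, ← hFG₀, Matrix.mul_assoc, Matrix.mul_assoc, hGF₀,
                Matrix.mul_one]
        have h4 : g₀ x * ((g x)⁻¹ : GL _ ℂ).1 = 1 := Units.mul_inv (g x)
        rw [h1, ← h3, Matrix.mul_assoc, h4, Matrix.mul_one]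
      simp only [h2]
      exact hJ₁ x

end TorusFrame

open Bundle

/-! ### Embedding a vector bundle over a compact space into a product bundle -/

namespace ComplexBundle

/-- An embedding of a complex vector bundle into a product bundle, with a projection. -/
structure SplitEmbedding {B : Type v} [TopologicalSpace B] (V : ComplexBundle.{u, v} B)
    (κ : Type w) where
  /-- the embedding on fibres -/
  incl : ∀ x, V.E x →ₗ[ℂ] (κ → ℂ)
  /-- the projection on fibres -/
  proj : ∀ x, (κ → ℂ) →ₗ[ℂ] V.E x
  proj_incl : ∀ x v, proj x (incl x v) = v
  isInducing : IsInducing fun q : V.Total ↦ (q.1, incl q.1 q.2)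
  continuous_incl_proj : Continuous fun q : B × (κ → ℂ) ↦ incl q.1 (proj q.1 q.2)

variable {B : Type v} [TopologicalSpace B] (V : ComplexBundle.{u, v} B)

/-- A cut-off local trivialisation is continuous. -/
theorem continuous_smul_linearMapAt (e : Trivialization V.Fib (π V.Fib V.E))
    [MemTrivializationAtlas e] (f : B → ℂ) (hf : Continuous f) (hs : tsupport f ⊆ e.baseSet) :
    Continuous fun q : V.Total ↦ f q.1 • e.linearMapAt ℂ q.1 q.2 := by
  have hπ : Continuous fun q : V.Total ↦ q.1 := FiberBundle.continuous_proj V.Fib V.E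
  refine continuous_of_tsupport fun q hq ↦ ?_
  have hq' : q.1 ∈ tsupport f := by
    have h0 : Function.support (fun q : V.Total ↦ f q.1 • e.linearMapAt ℂ q.1 q.2) ⊆
        (fun q : V.Total ↦ q.1) ⁻¹' tsupport f := fun q hq ↦ subset_closure fun h ↦ hq (by simp [h])
    exact closure_minimal h0 ((isClosed_tsupport f).preimage hπ) hq
  have hb : q.1 ∈ e.baseSet := hs hq'
  have h1 : ContinuousAt (fun q : V.Total ↦ (e q).2) q :=
    (e.continuousAt (e.mem_source.2 hb)).snd
  refine ((hf.comp hπ).continuousAt.smul h1).congr ?_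
  filter_upwards [(e.open_baseSet.preimage hπ).mem_nhds hb] with q' hq'
  change f q'.1 • (e q').2 = _
  rw [e.coe_linearMapAt_of_mem (R := ℂ) hq']

/-- A cut-off local frame is continuous. -/
theorem continuous_smul_symmₗ (e : Trivialization V.Fib (π V.Fib V.E))
    [MemTrivializationAtlas e] (f : B → ℂ) (hf : Continuous f) (hs : tsupport f ⊆ e.baseSet) :
    Continuous fun q : B × V.Fib ↦ (⟨q.1, f q.1 • e.symmₗ ℂ q.1 q.2⟩ : V.Total) := by
  rw [continuous_iff_continuousAt]
  rintro ⟨x, w⟩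
  by_cases hx : x ∈ e.baseSet
  · have h1 : ContinuousAt (fun q : B × V.Fib ↦ e.toOpenPartialHomeomorph.symm (q.1, f q.1 • q.2))
        (x, w) := by
      refine ContinuousAt.comp
        (f := fun q : B × V.Fib ↦ (q.1, f q.1 • q.2)) (g := e.toOpenPartialHomeomorph.symm) ?_ ?_
      · exact e.toOpenPartialHomeomorph.continuousAt_symm (e.mem_target.2 hx)
      · exact (by fun_prop : Continuous fun q : B × V.Fib ↦ (q.1, f q.1 • q.2)).continuousAt
    refine h1.congr ?_
    filter_upwards [(e.open_baseSet.preimage _root_.continuous_fst).mem_nhds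
      (show (x, w).1 ∈ e.baseSet from hx)] with q hq
    rw [← map_smul, e.symmₗ_apply hq]
    exact (e.mk_symm hq _).symm
  -- Away from the support of f the map agrees locally with the zero section.
  · have hx' : x ∉ tsupport f := fun h ↦ hx (hs h)
    have h1 : ContinuousAt (fun q : B × V.Fib ↦ zeroSection V.Fib V.E q.1) (x, w) :=
      ((Bundle.Trivialization.continuous_zeroSection ℂ).comp _root_.continuous_fst).continuousAt
    refine h1.congr ?_
    filter_upwards [((isClosed_tsupport f).isOpen_compl.preimage _root_.continuous_fst).mem_nhds
      (show (x, w).1 ∈ (tsupport f)ᶜ from hx')] with q hq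
    have : f q.1 = 0 := image_eq_zero_of_notMem_tsupport hq
    rw [this, zero_smul]
    rfl

/-- A complex vector bundle over a compact Hausdorff space is a direct summand of a product
bundle of finite rank. -/
theorem exists_splitEmbedding [CompactSpace B] [T2Space B] :
    ∃ (κ : Type v) (_ : Fintype κ), Nonempty (SplitEmbedding V κ) := by
  classical
  let e : B → Trivialization V.Fib (π V.Fib V.E) := fun x ↦ trivializationAt V.Fib V.E x
  obtain ⟨t, ht⟩ := isCompact_univ.elim_finite_subcover (fun x ↦ (e x).baseSet)
    (fun x ↦ (e x).open_baseSet)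
    (fun x _ ↦ Set.mem_iUnion.2 ⟨x, FiberBundle.mem_baseSet_trivializationAt' x⟩)
  obtain ⟨ρ, hρ⟩ := PartitionOfUnity.exists_isSubordinate isClosed_univ
    (fun j : t ↦ (e j).baseSet) (fun j ↦ (e j).open_baseSet) (fun x hx ↦ by
      obtain ⟨j, hj, hx⟩ := Set.mem_iUnion₂.1 (ht hx)
      exact Set.mem_iUnion.2 ⟨⟨j, hj⟩, hx⟩)
  -- Square roots, because each cut-off enters once in `incl` and once in `proj`; their squares sum
  -- to 1.
  let f : t → B → ℂ := fun j x ↦ (Real.sqrt (ρ j x) : ℂ)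
  have hf : ∀ j, Continuous (f j) := fun j ↦
    Complex.continuous_ofReal.comp (Real.continuous_sqrt.comp (ρ j).continuous)
  have hfs : ∀ j, tsupport (f j) ⊆ (e j).baseSet := fun j ↦ by
    have h0 : Function.support (f j) ⊆ Function.support (ρ j) := fun x hx h ↦ hx (by simp [f, h])
    exact (closure_mono h0).trans (hρ j)
  have hff : ∀ x, ∑ j, f j x * f j x = 1 := fun x ↦ by
    have h1 : ∑ j, ρ j x = 1 := by
      rw [← finsum_eq_sum_of_fintype]; exact ρ.sum_eq_one (Set.mem_univ x)
    have h2 : ∀ j, f j x * f j x = (ρ j x : ℂ) := fun j ↦ by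
      rw [← Complex.ofReal_mul, Real.mul_self_sqrt (ρ.nonneg j x)]
    simp only [h2]
    exact_mod_cast h1
  have hmem : ∀ j x, f j x ≠ 0 → x ∈ (e j).baseSet := fun j x h ↦ hfs j (subset_closure h)
  let b := Module.finBasis ℂ V.Fib
  let b' : V.Fib ≃L[ℂ] (Fin V.rank → ℂ) := b.equivFun.toContinuousLinearEquiv
  let incl : ∀ x, V.E x →ₗ[ℂ] (t × Fin V.rank → ℂ) := fun x ↦ LinearMap.pi fun ja ↦
    f ja.1 x • (LinearMap.proj ja.2 ∘ₗ b'.toLinearEquiv.toLinearMap ∘ₗ (e ja.1).linearMapAt ℂ x)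
  let proj : ∀ x, (t × Fin V.rank → ℂ) →ₗ[ℂ] V.E x := fun x ↦ ∑ j : t,
    f j x • ((e j).symmₗ ℂ x ∘ₗ b'.symm.toLinearEquiv.toLinearMap ∘ₗ
      LinearMap.funLeft ℂ ℂ fun a ↦ (j, a))
  have hincl : ∀ x v j a, incl x v (j, a) = b' (f j x • (e j).linearMapAt ℂ x v) a := by
    intro x v j a
    rw [map_smul]
    rfl
  have hproj : ∀ x c, proj x c = ∑ j : t, f j x • (e j).symmₗ ℂ x (b'.symm fun a ↦ c (j, a)) := by
    intro x c
    simp only [proj, LinearMap.sum_apply]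
    rfl
  have hcincl : ∀ j a, Continuous fun q : V.Total ↦ incl q.1 q.2 (j, a) := fun j a ↦ by
    simp only [hincl]
    exact (continuous_apply a).comp (b'.continuous.comp
      (V.continuous_smul_linearMapAt (e j) (f j) (hf j) (hfs j)))
  have hci : Continuous fun q : V.Total ↦ incl q.1 q.2 :=
    continuous_pi fun ja ↦ hcincl ja.1 ja.2
  have hπ : Continuous fun q : V.Total ↦ q.1 := FiberBundle.continuous_proj V.Fib V.E
  refine ⟨t × Fin V.rank, inferInstance, ⟨⟨incl, proj, fun x v ↦ ?_, ?_, ?_⟩⟩⟩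
  · rw [hproj]
    have : ∀ j : t, f j x • (e j).symmₗ ℂ x (b'.symm fun a ↦ incl x v (j, a)) =
        (f j x * f j x) • v := by
      intro j
      by_cases hj : f j x = 0
      · simp [hj]
      · simp only [hincl]
        change f j x • (e j).symmₗ ℂ x (b'.symm (b' (f j x • (e j).linearMapAt ℂ x v))) = _
        rw [b'.symm_apply_apply, map_smul, (e j).symmₗ_linearMapAt (hmem j x hj), smul_smul]
    simp only [this]
    rw [← Finset.sum_smul, hff, one_smul]
  · rw [isInducing_iff_nhds]
    intro q₀
    refine le_antisymm ((hπ.prodMk hci).tendsto q₀).le_comap ?_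
    -- Near `q₀` the fibre coordinate in the j-th trivialisation is recovered by dividing the j-th
    -- component of `incl` by the cut-off, so the embedding determines the topology.
    obtain ⟨j, hj⟩ : ∃ j, f j q₀.1 ≠ 0 := by
      by_contra! h
      have := hff q₀.1
      simp [h] at this
    change Filter.Tendsto id (Filter.comap (fun q : V.Total ↦ (q.1, incl q.1 q.2))
      (𝓝 (q₀.1, incl q₀.1 q₀.2))) (𝓝 q₀)
    rw [(e j).tendsto_nhds_iff ((e j).mem_source.2 (hmem j _ hj))]
    set l := Filter.comap (fun q : V.Total ↦ (q.1, incl q.1 q.2)) (𝓝 (q₀.1, incl q₀.1 q₀.2))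
    have hl : Filter.Tendsto (fun q : V.Total ↦ (q.1, incl q.1 q.2)) l
        (𝓝 (q₀.1, incl q₀.1 q₀.2)) := Filter.tendsto_comap
    have hl1 : Filter.Tendsto (fun q : V.Total ↦ q.1) l (𝓝 q₀.1) :=
      (_root_.continuous_fst.tendsto _).comp hl
    have hl2 : Filter.Tendsto (fun q : V.Total ↦ incl q.1 q.2) l (𝓝 (incl q₀.1 q₀.2)) :=
      (_root_.continuous_snd.tendsto _).comp hl
    refine ⟨hl1, ?_⟩
    have key : ∀ q : V.Total, f j q.1 ≠ 0 →
        (f j q.1)⁻¹ • b'.symm (fun a ↦ incl q.1 q.2 (j, a)) = (e j q).2 := by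
      intro q hq
      simp only [hincl]
      change (f j q.1)⁻¹ • b'.symm (b' (f j q.1 • (e j).linearMapAt ℂ q.1 q.2)) = _
      rw [b'.symm_apply_apply, smul_smul, inv_mul_cancel₀ hq, one_smul,
        (e j).coe_linearMapAt_of_mem (R := ℂ) (hmem j _ hq)]
    rw [← key q₀ hj]
    refine Filter.Tendsto.congr' (f₁ := fun q : V.Total ↦
      (f j q.1)⁻¹ • b'.symm (fun a ↦ incl q.1 q.2 (j, a))) ?_ ?_
    · filter_upwards [hl1 (((hf j).isOpen_preimage _ isOpen_ne).mem_nhds hj)] with q hq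
      exact key q hq
    · refine ((((hf j).tendsto _).comp hl1).inv₀ hj).smul ((b'.symm.continuous.tendsto _).comp ?_)
      exact tendsto_pi_nhds.2 fun a ↦ tendsto_pi_nhds.1 hl2 (j, a)
  · have h1 : ∀ (j : t) (ja : t × Fin V.rank), Continuous fun q : B × (t × Fin V.rank → ℂ) ↦
        incl q.1 (f j q.1 • (e j).symmₗ ℂ q.1 (b'.symm fun a ↦ q.2 (j, a))) ja := by
      intro j ja
      refine (hcincl ja.1 ja.2).comp
        ((V.continuous_smul_symmₗ (e j) (f j) (hf j) (hfs j)).comp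
          (_root_.continuous_fst.prodMk (b'.symm.continuous.comp ?_)))
      fun_prop
    refine continuous_pi fun ja ↦ ?_
    simp only [hproj, map_sum, Finset.sum_apply]
    exact continuous_finsetSum _ fun j _ ↦ h1 j ja

variable {V}

theorem SplitEmbedding.continuous_incl {κ : Type w} (s : SplitEmbedding V κ) :
    Continuous fun q : V.Total ↦ s.incl q.1 q.2 :=
  _root_.continuous_snd.comp s.isInducing.continuous

theorem SplitEmbedding.continuous_proj {κ : Type w} (s : SplitEmbedding V κ) :
    Continuous fun q : B × (κ → ℂ) ↦ (⟨q.1, s.proj q.1 q.2⟩ : V.Total) :=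
  s.isInducing.continuous_iff.2 (_root_.continuous_fst.prodMk s.continuous_incl_proj)

theorem finrank_fiber (V : ComplexBundle.{u, v} B) (x : B) :
    Module.finrank ℂ (V.E x) = V.rank :=
  (VectorBundle.continuousLinearEquivAt ℂ V.Fib V.E x).toLinearEquiv.finrank_eq

end ComplexBundle

/-! ### Twisted bundles on the Brillouin torus -/

namespace PgTorus

instance : CompactSpace PgTorus :=
  inferInstanceAs (CompactSpace (Real.Angle × Real.Angle))

instance : T2Space PgTorus :=
  inferInstanceAs (T2Space (Real.Angle × Real.Angle))

/-- The standard twisted action on `ℂ ^ (m + m)`. -/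
def modelMatrix (m : ℕ) (a : ℤˣ) (k : PgTorus) :
    Matrix (Fin m ⊕ Fin m) (Fin m ⊕ Fin m) ℂ :=
  if a = -1 then blockRoot (Fin m) (ux k) else 1

theorem neg_one_smul (x y : Real.Angle) :
    (-1 : ℤˣ) • (show PgTorus from (x, y)) = (show PgTorus from (x, -y)) :=
  Prod.ext rfl (by change ((-1 : ℤˣ) : ℤ) • y = -y; simp)

/-- `Matrix.exists_equivariant_frame` in terms of the action on the Brillouin torus. -/
theorem exists_equivariant_frame {κ : Type*} [Fintype κ] [DecidableEq κ]
    (P Λ : PgTorus → Matrix κ κ ℂ) (hP : Continuous P) (hΛ : Continuous Λ)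
    (hPP : ∀ k, P k * P k = P k) (hΛP : ∀ k, Λ k * P k = Λ k)
    (hΛΛ : ∀ k, Λ ((-1 : ℤˣ) • k) * Λ k = (ux k : ℂ) • P k) :
    ∃ (m : ℕ) (S : PgTorus → Matrix κ (Fin m ⊕ Fin m) ℂ)
      (T : PgTorus → Matrix (Fin m ⊕ Fin m) κ ℂ), Continuous S ∧ Continuous T ∧
      (∀ k, T k * S k = 1) ∧ (∀ k, S k * T k = P k) ∧
      ∀ k, Λ k * S k = S ((-1 : ℤˣ) • k) * blockRoot (Fin m) (ux k) := by
  obtain ⟨m, S, T, hS, hT, hTS, hST, h⟩ := Matrix.exists_equivariant_frame P Λ hP hΛ hPP hΛP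
    (fun x y ↦ (congrArg (Λ · * _) (neg_one_smul x y).symm).trans (hΛΛ (x, y)))
  exact ⟨m, S, T, hS, hT, hTS, hST, fun k ↦
    (h k.1 k.2).trans (congrArg (S · * _) (neg_one_smul k.1 k.2).symm)⟩

/-- L₁L₁ = L₁ because the twist is 1 at (1, 1), and L₁ is injective. Working in the total space
avoids transporting between the fibres over k and 1 • k. -/
theorem twisted_one (V : TwistedBundle.{u} twist) (k : PgTorus) (ψ : V.E k) :
    (⟨(1 : ℤˣ) • k, V.L 1 k ψ⟩ : V.toComplexBundle.Total) = ⟨k, ψ⟩ := by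
  let Φ : V.toComplexBundle.Total → V.toComplexBundle.Total := fun q ↦
    ⟨(1 : ℤˣ) • q.1, V.L 1 q.1 q.2⟩
  have hinj : Function.Injective Φ := by
    rintro ⟨x, v⟩ ⟨y, w⟩ h
    have hxy : x = y := smul_left_cancel (1 : ℤˣ) (congrArg TotalSpace.proj h)
    subst hxy
    rw [TotalSpace.mk_inj] at h
    exact congrArg _ ((V.L 1 x).injective h)
  refine hinj ?_
  refine (V.L_L 1 1 k ψ).trans ?_
  have h1 : twist.val 1 1 (((1 : ℤˣ) * 1) • k) = 1 := by simp [twist]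
  rw [h1, Circle.coe_one, one_smul]
  change (fun a : ℤˣ ↦ (⟨a • k, V.L a k ψ⟩ : V.toComplexBundle.Total)) (1 * 1) = _
  rw [one_mul]

theorem twisted_neg_one_sq (V : TwistedBundle.{u} twist) (k : PgTorus) (ψ : V.E k) :
    (⟨(-1 : ℤˣ) • (-1 : ℤˣ) • k, V.L (-1) ((-1 : ℤˣ) • k) (V.L (-1) k ψ)⟩ :
      V.toComplexBundle.Total) = ⟨k, (ux k : ℂ) • ψ⟩ := by
  refine (V.L_L (-1) (-1) k ψ).trans ?_
  have h1 : twist.val (-1) (-1) (((-1 : ℤˣ) * -1) • k) = ux k := by simp [twist]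
  rw [h1, ← map_smul, ← twisted_one V k ((ux k : ℂ) • ψ)]
  change (fun a : ℤˣ ↦ (⟨a • k, V.L a k ((ux k : ℂ) • ψ)⟩ : V.toComplexBundle.Total)) (-1 * -1) = _
  rw [neg_mul_neg, one_mul]

/-- Every twisted bundle is isomorphic to a standard one: it has a global frame in which the
twisted action is given by `modelMatrix`. -/
theorem exists_standard_frame (V : TwistedBundle.{u} twist) :
    ∃ (m : ℕ) (f : ∀ k, V.E k ≃ₗ[ℂ] (Fin m ⊕ Fin m → ℂ)),
      Continuous (fun q : V.toComplexBundle.Total ↦ f q.1 q.2) ∧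
      Continuous (fun q : PgTorus × (Fin m ⊕ Fin m → ℂ) ↦
        (⟨q.1, (f q.1).symm q.2⟩ : V.toComplexBundle.Total)) ∧
      ∀ a k ψ, f (a • k) (V.L a k ψ) = modelMatrix m a k *ᵥ f k ψ := by
  classical
  obtain ⟨κ, _, ⟨s⟩⟩ := V.toComplexBundle.exists_splitEmbedding
  let I : V.toComplexBundle.Total → κ → ℂ := fun q ↦ s.incl q.1 q.2
  let P : PgTorus → Matrix κ κ ℂ := fun k ↦
    LinearMap.toMatrix' (s.incl k ∘ₗ s.proj k)
  -- The action of -1 extended by zero on the kernel of P; hence ΛP = Λ, and the twisting relation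
  -- becomes Λ² = zP.
  let Λ : PgTorus → Matrix κ κ ℂ := fun k ↦
    LinearMap.toMatrix' (s.incl ((-1 : ℤˣ) • k) ∘ₗ
      (V.L (-1) k).toLinearMap ∘ₗ s.proj k)
  have hPv : ∀ k v, P k *ᵥ v = s.incl k (s.proj k v) := fun k v ↦
    LinearMap.toMatrix'_mulVec _ _
  have hΛv : ∀ k v, Λ k *ᵥ v = I ⟨(-1 : ℤˣ) • k, V.L (-1) k (s.proj k v)⟩ :=
    fun k v ↦ LinearMap.toMatrix'_mulVec _ _
  have hext : ∀ {A A' : Matrix κ κ ℂ}, (∀ v, A *ᵥ v = A' *ᵥ v) → A = A' := fun h ↦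
    Matrix.toLin'.injective (LinearMap.ext h)
  have hP : Continuous P := by
    refine continuous_matrix fun i j ↦ ?_
    have : ∀ k, P k i j = (s.incl k (s.proj k (Pi.single j 1))) i := fun k ↦ by
      rw [← hPv, mulVec_single_one]; rfl
    simp only [this]
    exact (continuous_apply i).comp (s.continuous_incl_proj.comp
      (continuous_id.prodMk continuous_const))
  have hΛ : Continuous Λ := by
    refine continuous_matrix fun i j ↦ ?_
    have : ∀ k, Λ k i j =
        I ⟨(-1 : ℤˣ) • k, V.L (-1) k (s.proj k (Pi.single j 1))⟩ i := fun k ↦ by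
      rw [← hΛv, mulVec_single_one]; rfl
    simp only [this]
    exact (continuous_apply i).comp (s.continuous_incl.comp ((V.continuous_L (-1)).comp
      (s.continuous_proj.comp (continuous_id.prodMk continuous_const))))
  obtain ⟨m, S, T, hS, hT, hTS, hST, hΛS⟩ := exists_equivariant_frame P Λ hP hΛ
    (fun k ↦ hext fun v ↦ by rw [← mulVec_mulVec, hPv, hPv, s.proj_incl])
    (fun k ↦ hext fun v ↦ by rw [← mulVec_mulVec, hPv, hΛv, hΛv, s.proj_incl])
    (fun k ↦ hext fun v ↦ by
      rw [← mulVec_mulVec, hΛv k, hΛv, s.proj_incl, smul_mulVec, hPv]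
      refine (congrArg I (twisted_neg_one_sq V k (s.proj k v))).trans ?_
      exact map_smul (s.incl _) _ _)
  have hPI : ∀ k (ψ : V.E k), P k *ᵥ s.incl k ψ = s.incl k ψ := fun k ψ ↦ by
    rw [hPv, s.proj_incl]
  have hPS : ∀ k, P k * S k = S k := fun k ↦ by
    rw [← hST, Matrix.mul_assoc, hTS, Matrix.mul_one]
  let f : ∀ k, V.E k ≃ₗ[ℂ] (Fin m ⊕ Fin m → ℂ) := fun k ↦
    { (T k).mulVecLin ∘ₗ s.incl k with
      invFun := fun c ↦ s.proj k (S k *ᵥ c)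
      left_inv := fun ψ ↦ by
        change s.proj k (S k *ᵥ (T k *ᵥ s.incl k ψ)) = ψ
        rw [mulVec_mulVec, hST, hPI, s.proj_incl]
      right_inv := fun c ↦ by
        change T k *ᵥ s.incl k (s.proj k (S k *ᵥ c)) = c
        rw [← hPv, mulVec_mulVec _ (P k), hPS, mulVec_mulVec, hTS, one_mulVec] }
  have hf : ∀ k ψ, f k ψ = T k *ᵥ s.incl k ψ := fun k ψ ↦ rfl
  have hπ : Continuous fun q : V.toComplexBundle.Total ↦ q.1 :=
    FiberBundle.continuous_proj V.Fib V.E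
  refine ⟨m, f, (hT.comp hπ).matrix_mulVec s.continuous_incl, ?_, fun a k ψ ↦ ?_⟩
  · exact s.continuous_proj.comp
      (continuous_fst.prodMk ((hS.comp continuous_fst).matrix_mulVec continuous_snd))
  · rcases Int.units_eq_one_or a with rfl | rfl
    · rw [show modelMatrix m 1 k = 1 from if_neg (by decide), one_mulVec]
      exact congrArg (fun q : V.toComplexBundle.Total ↦ f q.1 q.2) (twisted_one V k ψ)
    · rw [show modelMatrix m (-1) k = blockRoot (Fin m) (ux k) from if_pos rfl, hf, hf]
      have h1 : s.incl ((-1 : ℤˣ) • k) (V.L (-1) k ψ) = Λ k *ᵥ s.incl k ψ := by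
        rw [hΛv, s.proj_incl]
      have h2 : Λ k *ᵥ s.incl k ψ =
          S ((-1 : ℤˣ) • k) *ᵥ (blockRoot (Fin m) (ux k) *ᵥ (T k *ᵥ s.incl k ψ)) := by
        rw [mulVec_mulVec, ← hΛS, ← mulVec_mulVec, mulVec_mulVec _ (S k), hST, hPI]
      rw [h1, h2, mulVec_mulVec, hTS, one_mulVec]

end PgTorus

/-! ### The rank as a complete invariant, and the K-group -/

namespace PgTorus

theorem rank_eq_of_frame (V : TwistedBundle.{u} twist) {m : ℕ}
    (f : ∀ k, V.E k ≃ₗ[ℂ] (Fin m ⊕ Fin m → ℂ)) : V.toComplexBundle.rank = m + m := by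
  have k : PgTorus := ((0 : Real.Angle), (0 : Real.Angle))
  rw [← V.toComplexBundle.finrank_fiber k, (f k).finrank_eq]
  simp

theorem even_rank (V : TwistedBundle.{u} twist) : Even V.toComplexBundle.rank := by
  obtain ⟨m, f, -⟩ := exists_standard_frame V
  exact ⟨m, rank_eq_of_frame V f⟩

theorem isTrivialisable (V : TwistedBundle.{u} twist) : V.toComplexBundle.IsTrivialisable := by
  obtain ⟨m, f, hf, hf', -⟩ := exists_standard_frame V
  let F := EuclideanSpace ℂ (Fin V.toComplexBundle.rank)
  have hcard : Module.finrank ℂ (Fin m ⊕ Fin m → ℂ) = Module.finrank ℂ F := by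
    rw [finrank_euclideanSpace_fin, rank_eq_of_frame V f]
    simp
  let φ : (Fin m ⊕ Fin m → ℂ) ≃L[ℂ] F := ContinuousLinearEquiv.ofFinrankEq hcard
  let e := Bundle.Trivial.homeomorphProd PgTorus F
  refine ⟨⟨fun k ↦ (f k).trans φ.toLinearEquiv, ?_, ?_⟩⟩
  · exact e.symm.continuous.comp
      ((FiberBundle.continuous_proj V.Fib V.E).prodMk (φ.continuous.comp hf))
  · exact hf'.comp ((continuous_fst.prodMk (φ.symm.continuous.comp continuous_snd)).comp
      e.continuous)

/-- Twisted bundles of the same rank are isomorphic. -/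
theorem isIso_of_rank_eq {V W : TwistedBundle.{u} twist}
    (h : V.toComplexBundle.rank = W.toComplexBundle.rank) : V.IsIso W := by
  obtain ⟨m, f, hf, hf', hfL⟩ := exists_standard_frame V
  obtain ⟨m', g, hg, hg', hgL⟩ := exists_standard_frame W
  obtain rfl : m = m' := by
    rw [rank_eq_of_frame V f, rank_eq_of_frame W g] at h
    omega
  -- Both frames carry the action to the same model matrices, so composing one with the inverse of
  -- the other intertwines the actions.
  refine ⟨⟨fun k ↦ (f k).trans (g k).symm, ?_, ?_⟩, fun a k ψ ↦ ?_⟩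
  · exact hg'.comp ((FiberBundle.continuous_proj V.Fib V.E).prodMk hf)
  · exact hf'.comp ((FiberBundle.continuous_proj W.Fib W.E).prodMk hg)
  · change (g (a • k)).symm (f (a • k) (V.L a k ψ)) = W.L a k ((g k).symm (f k ψ))
    rw [LinearEquiv.symm_apply_eq, hfL, hgL, LinearEquiv.apply_symm_apply]

theorem rank_eq_of_isIso {V W : TwistedBundle.{u} twist} (h : V.IsIso W) :
    V.toComplexBundle.rank = W.toComplexBundle.rank := by
  obtain ⟨f, -⟩ := h
  have k : PgTorus := ((0 : Real.Angle), (0 : Real.Angle))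
  rw [← V.toComplexBundle.finrank_fiber k, ← W.toComplexBundle.finrank_fiber k,
    (f.map k).finrank_eq]

/-- Half the rank, as a homomorphism on isomorphism classes of twisted bundles. -/
def halfRank : TwistedVect.{u} twist →+ ℤ where
  toFun := Quotient.lift (fun V ↦ ((V.toComplexBundle.rank / 2 : ℕ) : ℤ)) fun _ _ h ↦ by
    rw [rank_eq_of_isIso h]
  map_zero' := by
    change ((Module.finrank ℂ PUnit.{u + 1} / 2 : ℕ) : ℤ) = 0
    rw [Module.finrank_zero_of_subsingleton]
    rfl
  map_add' := by
    rintro ⟨V⟩ ⟨W⟩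
    change ((Module.finrank ℂ (V.Fib × W.Fib) / 2 : ℕ) : ℤ) =
      ((Module.finrank ℂ V.Fib / 2 : ℕ) : ℤ) + ((Module.finrank ℂ W.Fib / 2 : ℕ) : ℤ)
    -- Truncated division by 2 is additive here only because both ranks are even.
    obtain ⟨a, ha⟩ := even_rank V
    obtain ⟨b, hb⟩ := even_rank W
    change Module.finrank ℂ V.Fib = a + a at ha
    change Module.finrank ℂ W.Fib = b + b at hb
    rw [Module.finrank_prod, ha, hb]
    omega

theorem two_mul_halfRank (V : TwistedBundle.{u} twist) :
    2 * halfRank (TwistedVect.mk V) = V.toComplexBundle.rank := by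
  change 2 * ((V.toComplexBundle.rank / 2 : ℕ) : ℤ) = _
  obtain ⟨a, ha⟩ := even_rank V
  omega

theorem halfRank_injective : Function.Injective (halfRank : TwistedVect.{u} twist →+ ℤ) := by
  rintro ⟨V⟩ ⟨W⟩ h
  refine Quotient.sound (isIso_of_rank_eq ?_)
  have hV := two_mul_halfRank V
  have hW := two_mul_halfRank W
  change halfRank (TwistedVect.mk V) = halfRank (TwistedVect.mk W) at h
  rw [h] at hV
  omega

/-- Half the rank, as a homomorphism on twisted K-theory. -/
def kHalfRank : TwistedK.{u} twist →+ ℤ :=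
  Algebra.GrothendieckAddGroup.lift halfRank

theorem kHalfRank_of (x : TwistedVect.{u} twist) :
    kHalfRank (Algebra.GrothendieckAddGroup.of x) = halfRank x :=
  DFunLike.congr_fun (Algebra.GrothendieckAddGroup.lift.symm_apply_apply halfRank) x

theorem two_mul_kHalfRank (V : TwistedBundle.{u} twist) :
    2 * kHalfRank V.kClass = V.toComplexBundle.rank := by
  rw [TwistedBundle.kClass, kHalfRank_of, two_mul_halfRank]

theorem kHalfRank_regularBundle : kHalfRank regularBundle.kClass = 1 := by
  have h := two_mul_kHalfRank regularBundle
  have h2 : regularBundle.toComplexBundle.rank = 2 := by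
    change Module.finrank ℂ (Fin 2 → ℂ) = 2
    simp
  rw [h2] at h
  omega

/-- Each class is a difference [a] - [b]. If its half rank vanishes, a and b have equal half rank,
and `halfRank_injective` already gives a = b in the monoid. -/
theorem kHalfRank_injective : Function.Injective (kHalfRank : TwistedK.{u} twist →+ ℤ) := by
  rw [injective_iff_map_eq_zero]
  intro x hx
  obtain ⟨⟨a, b⟩, hab⟩ :=
    (AddLocalization.addMonoidOf (⊤ : AddSubmonoid (TwistedVect.{u} twist))).surj x
  change x + Algebra.GrothendieckAddGroup.of b.1 = Algebra.GrothendieckAddGroup.of a at hab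
  have h := congrArg kHalfRank hab
  rw [map_add, hx, zero_add, kHalfRank_of, kHalfRank_of] at h
  rw [halfRank_injective h] at hab
  exact add_eq_right.1 hab

end PgTorus

end

theorem mainTheorem9 :
    (∀ V : TwistedBundle.{u} PgTorus.twist,
      V.toComplexBundle.IsTrivialisable ∧ Even V.toComplexBundle.rank) ∧
    (∃ e : TwistedK.{0} PgTorus.twist ≃+ ℤ,
      (∀ V : TwistedBundle.{0} PgTorus.twist, 2 * e V.kClass = (V.toComplexBundle.rank : ℤ)) ∧
      e PgTorus.regularBundle.kClass = 1) ∧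
    AddSubgroup.zmultiples PgTorus.regularBundle.kClass = ⊤ := by
  have hsurj : Function.Surjective (PgTorus.kHalfRank : TwistedK.{0} PgTorus.twist →+ ℤ) :=
    fun n ↦ ⟨n • PgTorus.regularBundle.kClass, by
      rw [map_zsmul, PgTorus.kHalfRank_regularBundle, smul_eq_mul, mul_one]⟩
  refine ⟨fun V ↦ ⟨PgTorus.isTrivialisable V, PgTorus.even_rank V⟩,
    ⟨AddEquiv.ofBijective PgTorus.kHalfRank ⟨PgTorus.kHalfRank_injective, hsurj⟩,
      PgTorus.two_mul_kHalfRank, PgTorus.kHalfRank_regularBundle⟩, ?_⟩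
  -- A class and the multiple of the regular class by its half rank have the same image in ℤ.
  refine (AddSubgroup.eq_top_iff' _).2 fun x ↦ AddSubgroup.mem_zmultiples_iff.2
    ⟨PgTorus.kHalfRank x, PgTorus.kHalfRank_injective ?_⟩
  rw [map_zsmul, PgTorus.kHalfRank_regularBundle, smul_eq_mul, mul_one]
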